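/- Fix $d\ge 1$, radii $0<r_n<1/4$ and integers $k_n\ge 2$ ($n\in\mathbb N$). Let $N_n$ be Poisson with mean $n$, and let $X_1,X_2,\dots$ be i.i.d. uniform on $[0,1]^d$, independent of $N_n$. The graph $G(n,r_n)$ has vertex set $V=\{1,\dots,N_n\}$, and distinct $i,j$ are adjacent iff $d_T(X_i,X_j)\le r_n$, where $d_T(x,y)=\bigl(\sum_{l=1}^d \min(|x_l-y_l|,1-|x_l-y_l|)^2\bigr)^{1/2}$. The graph $G_{k_n}(n,r_n)$ is obtained by choosing, independently of the positions, a uniformly random set $K_n$ of $k_n$ vertices (all vertices, if $N_n<k_n$) and adding all missing edges between vertices of $K_n$. The vertex-degree algorithm outputs a set of $k_n$ vertices with the largest degrees in $G_{k_n}(n,r_n)$ (all vertices, if $N_n<k_n$). Let $\mu_n=n\phi_d r_n^d$, where $\phi_d$ is the volume of the $d$-dimensional Euclidean unit ball, let $H(x)=1-x+x\log x$, and let $H_+^{-1}:[0,\infty)\to[1,\infty)$ be the inverse of the restriction of $H$ to $[1,\infty)$. Suppose that either (i) $\lim_{n\to\infty}\mu_n/\log n=\alpha\in(0,\infty)$ and,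 for some fixed $\varepsilon\in(0,1)$, $k_n\le(1-\varepsilon)(T(n)-\mu_n)$ for all large $n$, where $T(n)=\mu_n H_+^{-1}(1/\alpha)$; or (ii) $\lim_{n\to\infty}\mu_n/\log n=\infty$, $\mu_n=o(n)$ and $k_n=o(\sqrt{\mu_n})$. Then the vertex-degree algorithm fails to recover $K_n$ asymptotically almost surely, however it breaks ties: the probability that $K_n$ is not a possible output of the algorithm (that is, that no way of breaking ties makes the output equal to $K_n$) tends to $1$ as $n\to\infty$. -/

import Mathlib

open MeasureTheory ProbabilityTheory Filter Topology Asymptotics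

noncomputable section

/-- The unit cube `[0,1]^d`. Its canonical measure `volume` is the uniform distribution. -/
abbrev Cube (d : ℕ) : Type := Fin d → unitInterval

/-- The toroidal Euclidean distance on the unit cube. -/
def torusDist {d : ℕ} (x y : Cube d) : ℝ :=
  √(∑ i, (min |(x i : ℝ) - y i| (1 - |(x i : ℝ) - y i|)) ^ 2)

theorem torusDist_comm {d : ℕ} (x y : Cube d) : torusDist x y = torusDist y x := by
  simp only [torusDist, abs_sub_comm]

/-- The hard geometric graph of radius `r` on points `x 0, …, x (N - 1)` of the torus. -/
def geometricGraph {d N : ℕ} (r : ℝ) (x : Fin N → Cube d) : SimpleGraph (Fin N) where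
  Adj i j := i ≠ j ∧ torusDist (x i) (x j) ≤ r
  symm := ⟨fun i j h => ⟨h.1.symm, torusDist_comm (x i) (x j) ▸ h.2⟩⟩
  loopless := ⟨fun _ h => h.1 rfl⟩

/-- The graph obtained from `G` by adding all missing edges between vertices of `K`. -/
def plantClique {V : Type*} (G : SimpleGraph V) (K : Finset V) : SimpleGraph V where
  Adj i j := G.Adj i j ∨ (i ≠ j ∧ i ∈ K ∧ j ∈ K)
  symm := ⟨fun _ _ h => h.imp (fun h => h.symm) fun h => ⟨h.1.symm, h.2.2, h.2.1⟩⟩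
  loopless := ⟨fun i h => h.elim (G.irrefl (v := i)) fun h => h.1 rfl⟩

open Classical in
/-- All possible outputs of the vertex-degree algorithm with input `(G, k)`: the sets of `k`
vertices with largest degrees. There is one output for each way of breaking ties between vertices
of equal degree. (If `G` has fewer than `k` vertices, then all of them are returned.) -/
def vdOutputs {V : Type*} [Fintype V] (G : SimpleGraph V) (k : ℕ) : Set (Finset V) :=
  {S | S.card = min k (Fintype.card V) ∧ ∀ i ∈ S, ∀ j ∉ S, G.degree j ≤ G.degree i}

/-- Outcomes: a number of vertices `N`, the positions `X 0, X 1, …`, and a set `K` of (labels of)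
clique vertices. The vertex set of the graph is `{0, …, N - 1}`. -/
abbrev Outcome (d : ℕ) : Type := ℕ × (ℕ → Cube d) × Finset ℕ

theorem cliqueChoices_nonempty (k N : ℕ) :
    (Finset.powersetCard (min k N) (Finset.range N)).Nonempty :=
  Finset.powersetCard_nonempty.2 (by simp)

/-- The uniform distribution on the subsets of size `k` of `{0, …, N - 1}` (on the one-point set
`{{0, …, N - 1}}` if `N < k`). -/
def cliqueLaw (k N : ℕ) : Measure (Finset ℕ) :=
  (PMF.uniformOfFinset (Finset.powersetCard (min k N) (Finset.range N))
    (cliqueChoices_nonempty k N)).toMeasure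

instance (k N : ℕ) : IsProbabilityMeasure (cliqueLaw k N) := by
  unfold cliqueLaw; infer_instance

/-- The conditional distribution of positions and clique given the number of vertices: the positions
are independent and uniform on the cube, and the clique is uniform and independent of them. -/
def positionsCliqueKernel (d k : ℕ) : Kernel ℕ ((ℕ → Cube d) × Finset ℕ) :=
  Kernel.ofFunOfCountable fun N =>
    (Measure.infinitePi fun _ : ℕ => (volume : Measure (Cube d))).prod (cliqueLaw k N)

instance (d k : ℕ) : IsMarkovKernel (positionsCliqueKernel d k) :=
  ⟨fun N => by
    change IsProbabilityMeasure
      ((Measure.infinitePi fun _ : ℕ => (volume : Measure (Cube d))).prod (cliqueLaw k N))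
    infer_instance⟩

/-- The joint law of the number of vertices (Poisson with mean `n`), positions and clique. -/
def plantedLaw (d n k : ℕ) : Measure (Outcome d) :=
  (poissonMeasure (n : NNReal)) ⊗ₘ (positionsCliqueKernel d k)

instance (d n k : ℕ) : IsProbabilityMeasure (plantedLaw d n k) := by
  unfold plantedLaw; infer_instance

/-- The planted clique, as a set of vertices of the random graph. -/
def plantedSet {d : ℕ} (ω : Outcome d) : Finset (Fin ω.1) :=
  Finset.univ.filter fun i => (i : ℕ) ∈ ω.2.2

/-- The random geometric graph of radius `r` with the planted clique. -/
def plantedGraph {d : ℕ} (r : ℝ) (ω : Outcome d) : SimpleGraph (Fin ω.1) :=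
  plantClique (geometricGraph r fun i => ω.2.1 i) (plantedSet ω)

/-- The event that the vertex-degree algorithm fails to recover the planted clique, whichever way
it breaks ties. -/
def vdFails (d : ℕ) (r : ℝ) (k : ℕ) : Set (Outcome d) :=
  {ω | plantedSet ω ∉ vdOutputs (plantedGraph r ω) k}

/-- The average degree `μ = n φ_d r^d`, with `φ_d` the volume of the Euclidean unit ball. -/
def meanDegree (d n : ℕ) (r : ℝ) : ℝ :=
  n * volume.real (Metric.ball (0 : EuclideanSpace ℝ (Fin d)) 1) * r ^ d

/-- The entropy function `H(x) = 1 - x + x log x`. -/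
def entropyH (x : ℝ) : ℝ := 1 - x + x * Real.log x

/-- The upper branch of the inverse of `H`, with values in `[1, ∞)`. -/
def entropyInv (y : ℝ) : ℝ := Function.invFunOn entropyH (Set.Ici 1) y

/-- `entropyInv` is well defined: `H` maps `[1, ∞)` bijectively onto `[0, ∞)`. -/
theorem entropyH_bijOn : Set.BijOn entropyH (Set.Ici 1) (Set.Ici 0) := by
  have hc : Continuous entropyH := by
    unfold entropyH
    exact (continuous_const.sub continuous_id).add Real.continuous_mul_log
  have hm : StrictMonoOn entropyH (Set.Ici 1) := by
    apply strictMonoOn_of_deriv_pos (convex_Ici 1) hc.continuousOn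
    intro x hx
    rw [interior_Ici, Set.mem_Ioi] at hx
    have hd : HasDerivAt entropyH (0 - 1 + (Real.log x + 1)) x :=
      ((hasDerivAt_const x 1).sub (hasDerivAt_id x)).add (Real.hasDerivAt_mul_log (by linarith))
    rw [hd.deriv]
    linarith [Real.log_pos hx]
  have h1 : entropyH 1 = 0 := by simp [entropyH]
  refine ⟨fun x hx => ?_, hm.injOn, fun y hy => ?_⟩
  · rw [Set.mem_Ici, ← h1]
    exact hm.monotoneOn Set.self_mem_Ici hx hx
  · have hb : y ≤ entropyH (Real.exp (2 + y)) := by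
      have he := Real.add_one_le_exp (2 + y)
      rw [Set.mem_Ici] at hy
      simp only [entropyH, Real.log_exp]
      nlinarith
    have h2 : (1 : ℝ) ≤ Real.exp (2 + y) := Real.one_le_exp (by rw [Set.mem_Ici] at hy; linarith)
    obtain ⟨x, hx, rfl⟩ := intermediate_value_Icc h2 hc.continuousOn ⟨h1 ▸ hy, hb⟩
    exact ⟨x, hx.1, rfl⟩

theorem entropyInv_spec {y : ℝ} (hy : 0 ≤ y) :
    1 ≤ entropyInv y ∧ entropyH (entropyInv y) = y :=
  ⟨Function.invFunOn_mem (entropyH_bijOn.surjOn hy), Function.invFunOn_eq (entropyH_bijOn.surjOn hy)⟩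

/-- The asymptotic maximal degree `T = μ H₊⁻¹(1/α)` in the regime `μ / log n → α ∈ (0, ∞)`. -/
def maxDegreeScale (μ α : ℝ) : ℝ := μ * entropyInv α⁻¹

end

/-!
A vertex of the clique has degree at most `k` more than in the geometric graph, so the algorithm
fails as soon as the geometric degree of some vertex outside the clique exceeds that of a fixed
vertex of the clique by more than `k`. By Chebyshev's inequality the fixed vertex has fewer than
`μ + 3 L √μ` neighbours up to probability `O(L⁻²)`. Let `v` be the volume of a ball of radius `r`
and take about `v⁻¹` candidates outside the clique. The number of the remaining points in the ball
around a candidate is binomial; for two candidates at distance more than `2 r` these counts are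
negatively associated, and closer pairs have probability at most `2 ^ d v`. Hence the second moment
method finds a candidate with at least `μ + 3 L √μ + k` neighbours, provided that `v` is small
compared to the binomial probability of such a count. An exponential change of measure bounds this
probability from below: by a constant if `k` is of order `√μ`, and by `exp (-μ H(a) - O(√μ))` with
`α H(a) < 1` in the logarithmic regime, where `v = n ^ (-1 + o(1))`.
-/

/-! ### Binomial tails -/

/-- The expectation of `f` under the binomial distribution with parameters `n` and `p`, defined by
conditioning on one of the trials. -/
noncomputable def binomialMean (p : ℝ) : ℕ → (ℕ → ℝ) → ℝ
  | 0, f => f 0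
  | n + 1, f => p * binomialMean p n (fun s => f (s + 1)) + (1 - p) * binomialMean p n f

theorem binomialMean_mono {p : ℝ} (h0 : 0 ≤ p) (h1 : p ≤ 1) (n : ℕ) {f g : ℕ → ℝ}
    (hfg : ∀ s, f s ≤ g s) : binomialMean p n f ≤ binomialMean p n g := by
  induction n generalizing f g with
  | zero => exact hfg 0
  | succ n ih =>
    have : 0 ≤ 1 - p := sub_nonneg.2 h1
    simp only [binomialMean]
    gcongr
    · exact ih fun s => hfg (s + 1)
    · exact ih hfg

theorem binomialMean_const_mul (p c : ℝ) (n : ℕ) (f : ℕ → ℝ) :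
    binomialMean p n (fun s => c * f s) = c * binomialMean p n f := by
  induction n generalizing f with
  | zero => rfl
  | succ n ih => simp only [binomialMean, ih]; ring

theorem binomialMean_add_mul_sq (p a b c : ℝ) (n : ℕ) :
    binomialMean p n (fun s => b + a * ((s : ℝ) - c) ^ 2) =
      b + a * (n * p * (1 - p) + (n * p - c) ^ 2) := by
  induction n generalizing c with
  | zero => simp [binomialMean]
  | succ n ih =>
    have hshift (s : ℕ) : ((s + 1 : ℕ) : ℝ) - c = s - (c - 1) := by push_cast; ring
    simp only [binomialMean, hshift, ih]
    push_cast
    ring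

theorem binomialMean_tilt {p q : ℝ} (hq : q ≠ 0) (hp1 : p ≠ 1) (hq1 : q ≠ 1) (n : ℕ)
    (f : ℕ → ℝ) :
    binomialMean p n f = ((1 - p) / (1 - q)) ^ n *
      binomialMean q n (fun s => (p / q * ((1 - q) / (1 - p))) ^ s * f s) := by
  have hp' : 1 - p ≠ 0 := sub_ne_zero.2 hp1.symm
  have hq' : 1 - q ≠ 0 := sub_ne_zero.2 hq1.symm
  induction n generalizing f with
  | zero => simp [binomialMean]
  | succ n ih =>
    simp only [binomialMean, pow_succ', mul_assoc, binomialMean_const_mul, ih f,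
      ih fun s => f (s + 1)]
    generalize binomialMean q n _ = a
    generalize binomialMean q n _ = b
    field_simp

/-- The probability that a binomial random variable with parameters `n` and `p` is at least `t`. -/
noncomputable def binomialTail (p : ℝ) (n : ℕ) (t : ℝ) : ℝ :=
  binomialMean p n (fun s => if t ≤ s then 1 else 0)

theorem binomialTail_nonneg {p : ℝ} (h0 : 0 ≤ p) (h1 : p ≤ 1) (n : ℕ) (t : ℝ) :
    0 ≤ binomialTail p n t := by
  have h := binomialMean_add_mul_sq p 0 0 0 n
  simp only [zero_mul, add_zero] at h
  rw [← h]
  exact binomialMean_mono h0 h1 n fun s => by split_ifs <;> norm_num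

theorem binomialTail_le {p : ℝ} (h0 : 0 ≤ p) (h1 : p ≤ 1) (n : ℕ) {t a : ℝ} (ha : 0 < a)
    (ht : n * p + a ≤ t) : binomialTail p n t ≤ n * p / a ^ 2 := by
  calc binomialTail p n t
      ≤ binomialMean p n (fun s => 0 + (a ^ 2)⁻¹ * ((s : ℝ) - n * p) ^ 2) := by
        refine binomialMean_mono h0 h1 n fun s => ?_
        split_ifs with hs
        · rw [zero_add, ← div_eq_inv_mul, one_le_div (by positivity)]
          gcongr
          linarith
        · positivity
    _ = (n * p - n * p * p) / a ^ 2 := by rw [binomialMean_add_mul_sq]; ring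
    _ ≤ n * p / a ^ 2 := by
        gcongr
        exact sub_le_self _ (by positivity)

/-- The indicator of `t ≤ s` is bounded below by a parabola, and on the window where the parabola
is positive the exponential weight is at least its value at the right end. -/
theorem exp_mul_one_sub_sq_le {b m t : ℝ} (hb : 0 ≤ b) (hm : 0 < m) (ht : t ≤ m - 2 * √m) (s : ℕ) :
    Real.exp (-((m + 2 * √m) * b)) * (1 + -(4 * m)⁻¹ * ((s : ℝ) - m) ^ 2) ≤
      Real.exp (-b) ^ s * if t ≤ s then 1 else 0 := by
  rw [← Real.exp_nat_mul]
  by_cases hs : ((s : ℝ) - m) ^ 2 < (2 * √m) ^ 2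
  · have hlt := abs_lt.1 (abs_lt_of_sq_lt_sq hs (by positivity))
    rw [if_pos (by linarith), mul_one, neg_mul]
    refine (mul_le_of_le_one_right (Real.exp_nonneg _) ?_).trans ?_
    · exact add_le_of_nonpos_right (neg_nonpos.2 (by positivity))
    · rw [Real.exp_le_exp, mul_neg, neg_le_neg_iff]
      gcongr
      linarith
  · refine (mul_nonpos_of_nonneg_of_nonpos (Real.exp_nonneg _) ?_).trans (by positivity)
    rw [mul_pow, Real.sq_sqrt hm.le] at hs
    rw [neg_mul, ← sub_eq_add_neg, sub_nonpos, ← div_eq_inv_mul, one_le_div (by positivity)]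
    linarith

theorem exp_le_binomialTail {p q : ℝ} (hp : 0 < p) (hpq : p ≤ q) (hq : q < 1) {n : ℕ} {t m : ℝ}
    (hm : m = n * q) (hm0 : 0 < m) (ht : t ≤ m - 2 * √m) :
    3 / 4 * Real.exp (n * Real.log ((1 - p) / (1 - q)) -
      (m + 2 * √m) * Real.log (q / p * ((1 - p) / (1 - q)))) ≤ binomialTail p n t := by
  have hq0 : 0 < q := hp.trans_le hpq
  set ρ := (1 - p) / (1 - q) with hρ
  have hρ1 : 1 ≤ ρ := by rw [hρ, le_div_iff₀ (sub_pos.2 hq)]; linarith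
  have hθ1 : 1 ≤ q / p * ρ := one_le_mul_of_one_le_of_one_le ((one_le_div hp).2 hpq) hρ1
  set b := Real.log (q / p * ρ)
  have hθ : p / q * ((1 - q) / (1 - p)) = Real.exp (-b) := by
    rw [Real.exp_neg, Real.exp_log (by linarith), hρ, mul_inv, inv_div, inv_div]
  have hmean : 3 / 4 ≤ binomialMean q n (fun s => 1 + -(4 * m)⁻¹ * ((s : ℝ) - m) ^ 2) := by
    have : -(4 * m)⁻¹ * (m * (1 - q) + (m - m) ^ 2) = -((1 - q) / 4) := by field_simp; ring
    rw [binomialMean_add_mul_sq, ← hm, this]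
    linarith
  rw [binomialTail, binomialMean_tilt hq0.ne' (by linarith) hq.ne, ← hρ, hθ, sub_eq_add_neg,
    Real.exp_add, Real.exp_nat_mul, Real.exp_log (by linarith)]
  calc _ ≤ ρ ^ n * (Real.exp (-((m + 2 * √m) * b)) *
        binomialMean q n (fun s => 1 + -(4 * m)⁻¹ * ((s : ℝ) - m) ^ 2)) := by
        rw [mul_left_comm, mul_comm (3 / 4 : ℝ)]
        gcongr
    _ ≤ _ := by
        rw [← binomialMean_const_mul]
        gcongr
        exact binomialMean_mono hq0.le hq.le n
          (exp_mul_one_sub_sq_le (Real.log_nonneg hθ1) hm0 ht)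

theorem div_le_log_one_sub_div_one_sub {p q : ℝ} (hp : p < 1) (hq : q < 1) :
    (q - p) / (1 - p) ≤ Real.log ((1 - p) / (1 - q)) := by
  have hp' : 0 < 1 - p := sub_pos.2 hp
  refine le_trans (le_of_eq ?_)
    (Real.one_sub_inv_le_log_of_pos (div_pos hp' (sub_pos.2 hq)))
  field_simp
  ring

theorem exp_entropyH_le_binomialTail {p x : ℝ} (hp : 0 < p) (hx : 1 ≤ x) (hxp : x * p ≤ 1 / 2)
    {n : ℕ} {t l : ℝ} (hl : l = n * p) (hl4 : 4 ≤ l) (ht : t ≤ x * l - 2 * √(x * l)) :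
    3 / 4 * Real.exp (-(l * entropyH x + 4 * (x - 1) * √(x * l) + 2 * p * (x - 1) ^ 2 * l)) ≤
      binomialTail p n t := by
  have hp2 : p ≤ 1 / 2 := by nlinarith
  have hpx : p ≤ x * p := le_mul_of_one_le_left hp.le hx
  have hm4 : 4 ≤ x * l := by nlinarith
  have hm : x * l = n * (x * p) := by rw [hl]; ring
  refine le_trans ?_ (exp_le_binomialTail hp hpx (by linarith) hm (by linarith) ht)
  gcongr
  have hρ0 : 0 < (1 - p) / (1 - x * p) := div_pos (by linarith) (by linarith)
  rw [mul_div_cancel_right₀ x hp.ne', Real.log_mul (by linarith) hρ0.ne']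
  set σ := Real.log ((1 - p) / (1 - x * p))
  set w := √(x * l)
  have hw : 2 * w ≤ x * l := by
    have : (2 * w) ^ 2 ≤ (x * l) ^ 2 := by rw [mul_pow, Real.sq_sqrt (by linarith)]; nlinarith
    exact le_of_sq_le_sq this (by linarith)
  have hσ : (x * p - p) / (1 - p) ≤ σ :=
    div_le_log_one_sub_div_one_sub (by linarith) (by linarith)
  have hlog : 0 ≤ w * ((x - 1) - Real.log x) :=
    mul_nonneg (Real.sqrt_nonneg _) (sub_nonneg.2 (Real.log_le_sub_one_of_pos (by linarith)))
  have hn : 0 ≤ (n : ℝ) - (x * l + 2 * w) := by nlinarith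
  have hmain : (x - 1) * l - 2 * p * (x - 1) * ((x - 1) * l + 2 * w) ≤
      (n - (x * l + 2 * w)) * σ := by
    refine le_trans ?_ (mul_le_mul_of_nonneg_left hσ hn)
    have hgap : 0 ≤ p * (x - 1) * ((x - 1) * l + 2 * w) := by
      have : 0 ≤ x - 1 := by linarith
      positivity
    rw [← mul_div_assoc, le_div_iff₀ (by linarith)]
    nlinarith
  have hpw : 0 ≤ (1 - 2 * p) * ((x - 1) * w) := by
    have : 0 ≤ x - 1 := by linarith
    have : 0 ≤ 1 - 2 * p := by linarith
    positivity
  rw [entropyH]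
  nlinarith

/-! ### Balls in the torus -/

theorem norm_coe_unitAddCircle_eq_min {t : ℝ} (ht : |t| ≤ 1) :
    ‖(t : UnitAddCircle)‖ = min |t| (1 - |t|) := by
  have habs : ‖(t : UnitAddCircle)‖ = ‖((|t| : ℝ) : UnitAddCircle)‖ := by
    rcases abs_choice t with h | h
    · rw [h]
    · rw [h, AddCircle.coe_neg, norm_neg]
  rw [habs, UnitAddCircle.norm_eq, abs_sub_round_eq_min]
  rcases ht.lt_or_eq with h | h
  · rw [Int.fract_eq_self.2 ⟨abs_nonneg t, h⟩]
  · simp [h]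

section Torus

variable {d : ℕ}

/-- The canonical map from the cube onto the torus, which identifies opposite faces. -/
def cubeToTorus (x : Cube d) : Fin d → UnitAddCircle := fun i => ((x i : ℝ) : UnitAddCircle)

theorem torusDist_eq_sqrt (x y : Cube d) :
    torusDist x y = √(∑ i, ‖cubeToTorus x i - cubeToTorus y i‖ ^ 2) := by
  unfold torusDist cubeToTorus
  congr! 3 with i
  rw [← AddCircle.coe_sub, norm_coe_unitAddCircle_eq_min]
  exact abs_sub_le_of_nonneg_of_le (x i).2.1 (x i).2.2 (y i).2.1 (y i).2.2

theorem torusDist_eq_dist (x y : Cube d) :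
    torusDist x y = dist (WithLp.toLp 2 (cubeToTorus x) : PiLp 2 fun _ : Fin d => UnitAddCircle)
      (WithLp.toLp 2 (cubeToTorus y)) := by
  rw [torusDist_eq_sqrt, dist_eq_norm, PiLp.norm_eq_of_L2]
  rfl

theorem torusDist_triangle (x y z : Cube d) : torusDist x z ≤ torusDist x y + torusDist y z := by
  simp only [torusDist_eq_dist]
  exact dist_triangle _ _ _

theorem continuous_torusDist : Continuous fun p : Cube d × Cube d => torusDist p.1 p.2 := by
  unfold torusDist
  fun_prop

theorem measurableSet_torusDist_le (r : ℝ) :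
    MeasurableSet {p : Cube d × Cube d | torusDist p.1 p.2 ≤ r} :=
  (isClosed_le continuous_torusDist continuous_const).measurableSet

/-- The closed ball of radius `r` about `x` in the torus. -/
def torusBall (r : ℝ) (x : Cube d) : Set (Cube d) := {y | torusDist x y ≤ r}

theorem disjoint_torusBall {r : ℝ} {x y : Cube d} (h : 2 * r < torusDist x y) :
    Disjoint (torusBall r x) (torusBall r y) := by
  refine Set.disjoint_left.2 fun z (hx : torusDist x z ≤ r) (hy : torusDist y z ≤ r) => ?_
  linarith [torusDist_triangle x z y, torusDist_comm z y]

theorem measurePreserving_cubeToTorus :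
    MeasurePreserving (cubeToTorus : Cube d → _) volume volume := by
  refine volume_preserving_pi (f := fun _ (t : unitInterval) => ((t : ℝ) : UnitAddCircle))
    fun _ => (UnitAddCircle.measurePreserving_mk 0).comp ?_
  rw [zero_add, Measure.restrict_congr_set (Ioc_ae_eq_Icc (μ := volume))]
  exact unitInterval.measurePreserving_coe

theorem sqrt_sum_sq_norm_coe_le_iff {r : ℝ} (hr : r < 1 / 2) (t : Fin d → ℝ) :
    (√(∑ i, ‖(t i : UnitAddCircle)‖ ^ 2) ≤ r ∧ ∀ i, t i ∈ Set.Ioc (-1 / 2 : ℝ) (-1 / 2 + 1)) ↔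
      √(∑ i, |t i| ^ 2) ≤ r := by
  have hnorm (h : ∀ i, |t i| ≤ 1 / 2) :
      ∑ i, ‖(t i : UnitAddCircle)‖ ^ 2 = ∑ i, |t i| ^ 2 :=
    Finset.sum_congr rfl fun i _ => by
      rw [(AddCircle.norm_coe_eq_abs_iff 1 one_ne_zero).2 (by simpa using h i)]
  constructor
  · rintro ⟨h, hbox⟩
    rwa [hnorm fun i => abs_le.2 ⟨by linarith [(hbox i).1], by linarith [(hbox i).2]⟩] at h
  · intro h
    have habs (i : Fin d) : |t i| ≤ r := by
      refine (Real.abs_le_sqrt ?_).trans h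
      rw [← sq_abs]
      exact Finset.single_le_sum (f := fun i => |t i| ^ 2) (fun _ _ => by positivity)
        (Finset.mem_univ i)
    refine ⟨by rwa [hnorm fun i => (habs i).trans hr.le], fun i => ?_⟩
    have := abs_le.1 (habs i)
    constructor <;> linarith

theorem volume_sqrt_sum_sq_norm_le {r : ℝ} (hr : r < 1 / 2) :
    volume {z : Fin d → UnitAddCircle | √(∑ i, ‖z i‖ ^ 2) ≤ r} =
      volume (Metric.closedBall (0 : EuclideanSpace ℝ (Fin d)) r) := by
  have hmeas : MeasurableSet {z : Fin d → UnitAddCircle | √(∑ i, ‖z i‖ ^ 2) ≤ r} :=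
    (isClosed_le (by fun_prop) continuous_const).measurableSet
  have hmk : MeasurePreserving (fun (t : Fin d → ℝ) i => (t i : UnitAddCircle))
      (Measure.pi fun _ => volume.restrict (Set.Ioc (-1 / 2) (-1 / 2 + 1))) volume :=
    measurePreserving_pi _ _ fun _ => UnitAddCircle.measurePreserving_mk _
  rw [← hmk.measure_preimage hmeas.nullMeasurableSet, ← Measure.restrict_pi_pi,
    Measure.restrict_apply (hmk.measurable hmeas), ← (PiLp.volume_preserving_toLp
      (Fin d)).measure_preimage Metric.isClosed_closedBall.measurableSet.nullMeasurableSet]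
  change volume _ = _
  congr 1
  ext t
  simpa [EuclideanSpace.norm_eq, Set.mem_pi] using sqrt_sum_sq_norm_coe_le_iff hr t

/-- The volume `φ_d r ^ d` of a ball of radius `r < 1 / 2` in the `d`-dimensional torus. -/
noncomputable def torusBallVolume (d : ℕ) (r : ℝ) : ℝ :=
  volume.real (Metric.ball (0 : EuclideanSpace ℝ (Fin d)) 1) * r ^ d

theorem volume_torusBall (x : Cube d) {r : ℝ} (h0 : 0 ≤ r) (hr : r < 1 / 2) :
    volume.real (torusBall r x) = torusBallVolume d r := by
  have htrans : MeasurePreserving (fun y : Cube d => -cubeToTorus x + cubeToTorus y)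
      volume volume :=
    (measurePreserving_add_left volume _).comp measurePreserving_cubeToTorus
  have hball : torusBall r x = (fun y => -cubeToTorus x + cubeToTorus y) ⁻¹'
      {z : Fin d → UnitAddCircle | √(∑ i, ‖z i‖ ^ 2) ≤ r} := by
    ext y
    simp [torusBall, torusDist_comm x, torusDist_eq_sqrt, ← sub_eq_neg_add]
  rw [measureReal_def, hball, htrans.measure_preimage
    (isClosed_le (by fun_prop) continuous_const).measurableSet.nullMeasurableSet,
    volume_sqrt_sum_sq_norm_le hr, Measure.addHaar_closedBall _ _ h0, finrank_euclideanSpace_fin,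
    ENNReal.toReal_mul, ENNReal.toReal_ofReal (by positivity), mul_comm]
  rfl

theorem torusBallVolume_pos {r : ℝ} (h0 : 0 < r) : 0 < torusBallVolume d r := by
  have : 0 < volume.real (Metric.ball (0 : EuclideanSpace ℝ (Fin d)) 1) :=
    ENNReal.toReal_pos (Metric.measure_ball_pos volume _ one_pos).ne' measure_ball_lt_top.ne
  unfold torusBallVolume
  positivity

theorem torusBallVolume_le_one {r : ℝ} (h0 : 0 ≤ r) (hr : r < 1 / 2) : torusBallVolume d r ≤ 1 :=
  volume_torusBall (0 : Cube d) h0 hr ▸ measureReal_le_one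

theorem torusBallVolume_two_mul (d : ℕ) (r : ℝ) :
    torusBallVolume d (2 * r) = 2 ^ d * torusBallVolume d r := by
  unfold torusBallVolume
  ring

end Torus

theorem meanDegree_eq_mul_torusBallVolume (d n : ℕ) (r : ℝ) :
    meanDegree d n r = n * torusBallVolume d r := mul_assoc _ _ _

/-! ### Counting i.i.d. points in sets -/

theorem measureReal_prodMk_mem_of_indepFun {Ω β γ : Type*} [MeasurableSpace Ω] [MeasurableSpace β]
    [MeasurableSpace γ] {P : Measure Ω} [IsProbabilityMeasure P] {f : Ω → β} {g : Ω → γ}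
    (hf : Measurable f) (hg : Measurable g) (h : IndepFun f g P) {E : Set (β × γ)}
    (hE : MeasurableSet E) :
    P.real {ω | (f ω, g ω) ∈ E} = ∫ ω', P.real {ω | (f ω', g ω) ∈ E} ∂P := by
  have hslice (ω' : Ω) : P {ω | (f ω', g ω) ∈ E} = P.map g (Prod.mk (f ω') ⁻¹' E) :=
    (Measure.map_apply hg (measurable_prodMk_left hE)).symm
  have := Measure.isProbabilityMeasure_map (μ := P) hg.aemeasurable
  simp only [measureReal_def, hslice]
  have hslice_meas : Measurable fun ω' => P.map g (Prod.mk (f ω') ⁻¹' E) :=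
    (measurable_measure_prodMk_left hE).comp hf
  rw [integral_toReal hslice_meas.aemeasurable (Eventually.of_forall fun _ => measure_lt_top _ _)]
  change (P ((fun ω => (f ω, g ω)) ⁻¹' E)).toReal = _
  rw [← Measure.map_apply (hf.prodMk hg) hE,
    (indepFun_iff_map_prod_eq_prod_map_map hf.aemeasurable hg.aemeasurable).1 h,
    Measure.prod_apply hE, lintegral_map (measurable_measure_prodMk_left hE) hf]

section Counting

variable {ι α : Type*}

open Classical in
/-- The number of indices in `R` whose point lies in `B`. -/
noncomputable def countIn (R : Finset ι) (B : Set α) (x : ι → α) : ℕ := {l ∈ R | x l ∈ B}.card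

theorem countIn_empty (B : Set α) (x : ι → α) : countIn ∅ B x = 0 := by simp [countIn]

theorem countIn_insert [DecidableEq ι] {R : Finset ι} {a : ι} (ha : a ∉ R) (B : Set α) (x : ι → α)
    [Decidable (x a ∈ B)] :
    countIn (insert a R) B x = if x a ∈ B then countIn R B x + 1 else countIn R B x := by
  classical
  unfold countIn
  rw [Finset.filter_insert]
  split_ifs
  · rw [Finset.card_insert_of_notMem (by simp [ha])]
  · rfl

theorem countIn_eq_sum_indicator (R : Finset ι) (B : Set α) (x : ι → α) :
    countIn R B x = ∑ l ∈ R, B.indicator 1 (x l) := by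
  classical
  rw [countIn, Finset.card_filter]
  rfl

theorem countIn_restrict (R : Finset ι) (B : Set α) (x : ι → α) :
    countIn Finset.univ B (R.restrict x) = countIn R B x := by
  rw [countIn_eq_sum_indicator, countIn_eq_sum_indicator,
    ← Finset.sum_coe_sort R fun l => B.indicator 1 (x l)]
  rfl

variable [MeasurableSpace α]

theorem measurable_countIn {β : Type*} [MeasurableSpace β] (R : Finset ι) {B : β → Set α}
    (hB : MeasurableSet {p : β × α | p.2 ∈ B p.1}) :
    Measurable fun p : β × (ι → α) => countIn R (B p.1) p.2 := by
  simp only [countIn_eq_sum_indicator]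
  refine Finset.measurable_sum _ fun l _ => ?_
  have h : Measurable ({p : β × α | p.2 ∈ B p.1}.indicator (1 : β × α → ℕ)) :=
    measurable_one.indicator hB
  exact h.comp (measurable_fst.prodMk ((measurable_pi_apply l).comp measurable_snd))

theorem measurable_comp_countIn₂ (R : Finset ι) {B B' : Set α} (hB : MeasurableSet B)
    (hB' : MeasurableSet B') (F : ℕ → ℕ → ℝ) :
    Measurable fun x : ι → α => F (countIn R B x) (countIn R B' x) := by
  have hcount {D : Set α} (hD : MeasurableSet D) : Measurable (countIn (α := α) R D) :=
    (measurable_countIn R (B := fun _ : Unit => D) (measurable_snd hD)).comp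
      (measurable_const.prodMk measurable_id : Measurable fun x : ι → α => ((), x))
  exact (measurable_of_countable fun p : ℕ × ℕ => F p.1 p.2).comp ((hcount hB).prodMk (hcount hB'))

variable (ν : Measure α) [IsProbabilityMeasure ν]

theorem indepFun_restrict_infinitePi {S R : Finset ι} (h : Disjoint S R) :
    IndepFun (S.restrict (π := fun _ => α)) R.restrict (Measure.infinitePi fun _ : ι => ν) :=
  (iIndepFun_infinitePi (P := fun _ : ι => ν) (X := fun _ y => y)
    fun _ => measurable_id).indepFun_finset S R h fun i => measurable_pi_apply i

theorem indepFun_eval_restrict_infinitePi {R : Finset ι} {a : ι} (ha : a ∉ R) :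
    IndepFun (fun x : ι → α => x a) R.restrict (Measure.infinitePi fun _ : ι => ν) :=
  (indepFun_restrict_infinitePi ν (Finset.disjoint_singleton_left.2 ha)).comp
    (measurable_pi_apply (⟨a, Finset.mem_singleton_self a⟩ : ({a} : Finset ι))) measurable_id

theorem integrable_comp_countIn₂ (R : Finset ι) {B B' : Set α} (hB : MeasurableSet B)
    (hB' : MeasurableSet B') (F : ℕ → ℕ → ℝ) :
    Integrable (fun x => F (countIn R B x) (countIn R B' x))
      (Measure.infinitePi fun _ : ι => ν) := by
  refine Integrable.of_bound (measurable_comp_countIn₂ R hB hB' F).aestronglyMeasurable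
    (∑ p ∈ Finset.range (R.card + 1) ×ˢ Finset.range (R.card + 1), |F p.1 p.2|)
    (Eventually.of_forall fun x => ?_)
  have hcount (D : Set α) : countIn R D x ∈ Finset.range (R.card + 1) :=
    Finset.mem_range_succ_iff.2 (by classical exact Finset.card_filter_le _ _)
  exact Finset.single_le_sum (f := fun p : ℕ × ℕ => |F p.1 p.2|) (fun _ _ => abs_nonneg _)
    (Finset.mk_mem_product (hcount B) (hcount B'))

theorem integral_indicator_mul_comp_countIn₂ {R : Finset ι} {a : ι} (ha : a ∉ R) {A B B' : Set α}
    (hA : MeasurableSet A) (hB : MeasurableSet B) (hB' : MeasurableSet B') (F : ℕ → ℕ → ℝ) :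
    ∫ x, A.indicator 1 (x a) * F (countIn R B x) (countIn R B' x)
        ∂Measure.infinitePi (fun _ : ι => ν) =
      ν.real A * ∫ x, F (countIn R B x) (countIn R B' x) ∂Measure.infinitePi (fun _ : ι => ν) := by
  have hA' : Measurable (A.indicator (1 : α → ℝ)) := measurable_one.indicator hA
  have hindep := (indepFun_eval_restrict_infinitePi ν ha).comp hA'
    (measurable_comp_countIn₂ Finset.univ hB hB' F)
  have heval : ∫ x, A.indicator (1 : α → ℝ) (x a) ∂Measure.infinitePi (fun _ : ι => ν) =
      ν.real A := by
    rw [← integral_indicator_one hA]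
    have hmp := measurePreserving_eval_infinitePi (fun _ : ι => ν) a
    conv_rhs => rw [← hmp.map_eq]
    exact (integral_map hmp.measurable.aemeasurable hA'.aestronglyMeasurable).symm
  have hmul := hindep.integral_fun_mul_eq_mul_integral
    (hA'.comp (measurable_pi_apply a)).aestronglyMeasurable
    ((measurable_comp_countIn₂ Finset.univ hB hB' F).comp
      (Finset.measurable_restrict R)).aestronglyMeasurable
  simp only [Function.comp_apply, countIn_restrict] at hmul
  rw [hmul, heval]

theorem integral_comp_countIn₂_insert [DecidableEq ι] {R : Finset ι} {a : ι} (ha : a ∉ R)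
    {B B' : Set α} (hB : MeasurableSet B) (hB' : MeasurableSet B') (hd : Disjoint B B')
    (F : ℕ → ℕ → ℝ) :
    ∫ x, F (countIn (insert a R) B x) (countIn (insert a R) B' x)
        ∂Measure.infinitePi (fun _ : ι => ν) =
      ν.real B * ∫ x, F (countIn R B x + 1) (countIn R B' x) ∂Measure.infinitePi (fun _ : ι => ν) +
      ν.real B' * ∫ x, F (countIn R B x) (countIn R B' x + 1) ∂Measure.infinitePi (fun _ : ι => ν) +
      (1 - ν.real B - ν.real B') *
        ∫ x, F (countIn R B x) (countIn R B' x) ∂Measure.infinitePi (fun _ : ι => ν) := by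
  classical
  have hrest : ν.real (B ∪ B')ᶜ = 1 - ν.real B - ν.real B' := by
    rw [probReal_compl_eq_one_sub (hB.union hB'), measureReal_union hd hB']; ring
  have hint {A : Set α} (hA : MeasurableSet A) (F' : ℕ → ℕ → ℝ) :
      Integrable (fun x : ι → α => A.indicator 1 (x a) * F' (countIn R B x) (countIn R B' x))
        (Measure.infinitePi fun _ : ι => ν) := by
    refine (integrable_comp_countIn₂ ν R hB hB' F').bdd_mul (c := 1)
      ((measurable_one.indicator hA).comp (measurable_pi_apply a)).aestronglyMeasurable
      (Eventually.of_forall fun x => ?_)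
    by_cases h : x a ∈ A <;> simp [h]
  have i1 := hint hB fun s s' => F (s + 1) s'
  have i2 := hint hB' fun s s' => F s (s' + 1)
  have i3 := hint (hB.union hB').compl F
  rw [← integral_indicator_mul_comp_countIn₂ ν ha hB hB hB' fun s s' => F (s + 1) s',
    ← integral_indicator_mul_comp_countIn₂ ν ha hB' hB hB' fun s s' => F s (s' + 1), ← hrest,
    ← integral_indicator_mul_comp_countIn₂ ν ha (hB.union hB').compl hB hB' F,
    ← integral_add i1 i2, ← integral_add (by exact i1.add i2) i3]
  refine integral_congr_ae (Eventually.of_forall fun x => ?_)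
  have hx : x a ∈ B → x a ∉ B' := fun h h' => hd.le_bot ⟨h, h'⟩
  simp only [countIn_insert ha]
  by_cases h1 : x a ∈ B
  · simp [h1, hx h1]
  · by_cases h2 : x a ∈ B' <;> simp [h1, h2]

theorem integral_comp_countIn (R : Finset ι) {B : Set α} (hB : MeasurableSet B) (f : ℕ → ℝ) :
    ∫ x, f (countIn R B x) ∂Measure.infinitePi (fun _ : ι => ν) =
      binomialMean (ν.real B) R.card f := by
  classical
  induction R using Finset.induction_on generalizing f with
  | empty => simp [binomialMean, countIn_empty]
  | insert a R ha ih =>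
    have h := integral_comp_countIn₂_insert ν ha hB MeasurableSet.empty (by simp) fun s _ => f s
    simp only [measureReal_empty, zero_mul, add_zero, sub_zero] at h
    rw [h, Finset.card_insert_of_notMem ha, binomialMean, ih, ih fun s => f (s + 1)]

/-- Negative association. In the induction, the mixed increment
`(E f(S + 1) - E f(S)) (E g(S' + 1) - E g(S'))` is missing on the left and nonnegative. -/
theorem integral_mul_comp_countIn_le (R : Finset ι) {B B' : Set α} (hB : MeasurableSet B)
    (hB' : MeasurableSet B') (hd : Disjoint B B') {f g : ℕ → ℝ} (hf : Monotone f)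
    (hg : Monotone g) :
    ∫ x, f (countIn R B x) * g (countIn R B' x) ∂Measure.infinitePi (fun _ : ι => ν) ≤
      binomialMean (ν.real B) R.card f * binomialMean (ν.real B') R.card g := by
  classical
  induction R using Finset.induction_on generalizing f g with
  | empty => simp [binomialMean, countIn_empty]
  | insert a R ha ih =>
    rw [integral_comp_countIn₂_insert ν ha hB hB' hd fun s s' => f s * g s',
      Finset.card_insert_of_notMem ha, binomialMean, binomialMean]
    have hf' : Monotone fun s => f (s + 1) := fun _ _ h => hf (by omega)
    have hg' : Monotone fun s => g (s + 1) := fun _ _ h => hg (by omega)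
    have hrest : 0 ≤ 1 - ν.real B - ν.real B' := by
      have := measureReal_union hd hB' (μ := ν)
      have := measureReal_le_one (μ := ν) (s := B ∪ B')
      linarith
    have hincr {D : Set α} {h : ℕ → ℝ} (hh : Monotone h) :
        0 ≤ binomialMean (ν.real D) R.card (fun s => h (s + 1)) -
          binomialMean (ν.real D) R.card h :=
      sub_nonneg.2 (binomialMean_mono measureReal_nonneg measureReal_le_one _
        fun s => hh (Nat.le_succ s))
    have hmixed := mul_nonneg (mul_nonneg (measureReal_nonneg (μ := ν) (s := B))
      (measureReal_nonneg (μ := ν) (s := B'))) (mul_nonneg (hincr (D := B) hf) (hincr (D := B') hg))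
    have hih := add_le_add (add_le_add
      (mul_le_mul_of_nonneg_left (ih hf' hg) (measureReal_nonneg (μ := ν) (s := B)))
      (mul_le_mul_of_nonneg_left (ih hf hg') (measureReal_nonneg (μ := ν) (s := B'))))
      (mul_le_mul_of_nonneg_left (ih hf hg) hrest)
    refine hih.trans ?_
    linarith

theorem measureReal_le_countIn (R : Finset ι) {B : Set α} (hB : MeasurableSet B) (t : ℝ) :
    (Measure.infinitePi fun _ : ι => ν).real {x | t ≤ countIn R B x} =
      binomialTail (ν.real B) R.card t := by
  classical
  rw [binomialTail, ← integral_comp_countIn ν R hB, ← integral_indicator_one]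
  · refine integral_congr_ae (Eventually.of_forall fun x => ?_)
    simp [Set.indicator_apply]
  · exact measurableSet_le measurable_const (measurable_comp_countIn₂ R hB hB fun s _ => s)

theorem measureReal_le_countIn_and_le_countIn_le (R : Finset ι) {B B' : Set α}
    (hB : MeasurableSet B) (hB' : MeasurableSet B') (hd : Disjoint B B') (t : ℝ) :
    (Measure.infinitePi fun _ : ι => ν).real {x | t ≤ countIn R B x ∧ t ≤ countIn R B' x} ≤
      binomialTail (ν.real B) R.card t * binomialTail (ν.real B') R.card t := by
  classical
  have hmono : Monotone fun s : ℕ => if t ≤ s then (1 : ℝ) else 0 := fun a b hab => by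
    have : (a : ℝ) ≤ b := by exact_mod_cast hab
    dsimp only
    split_ifs <;> linarith
  refine le_trans (le_of_eq ?_) (integral_mul_comp_countIn_le ν R hB hB' hd hmono hmono)
  rw [← integral_indicator_one]
  · refine integral_congr_ae (Eventually.of_forall fun x => ?_)
    by_cases h : t ≤ countIn R B x <;> by_cases h' : t ≤ countIn R B' x <;> simp [h, h']
  · exact (measurableSet_le measurable_const (measurable_comp_countIn₂ R hB hB fun s _ => s)).inter
      (measurableSet_le measurable_const (measurable_comp_countIn₂ R hB' hB' fun s _ => s))

variable {ν} {B : α → Set α} (hB : MeasurableSet {p : α × α | p.2 ∈ B p.1}) {v : ℝ}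
  (hv : ∀ a, ν.real (B a) = v)
include hB hv

theorem measureReal_eval_mem {j l : ι} (hjl : j ≠ l) :
    (Measure.infinitePi fun _ : ι => ν).real {x | x l ∈ B (x j)} = v := by
  have hindep : IndepFun (fun x : ι → α => x j) (fun x => x l) (Measure.infinitePi fun _ => ν) :=
    (iIndepFun_infinitePi (P := fun _ : ι => ν) (X := fun _ y => y)
      fun _ => measurable_id).indepFun hjl
  have hslice (y : ι → α) : (Measure.infinitePi fun _ : ι => ν).real {x | x l ∈ B (y j)} = v :=
    ((measurePreserving_eval_infinitePi (fun _ : ι => ν) l).measureReal_preimage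
      (measurable_prodMk_left hB).nullMeasurableSet).trans (hv (y j))
  have h := measureReal_prodMk_mem_of_indepFun (measurable_pi_apply j) (measurable_pi_apply l)
    hindep hB
  simpa only [Set.mem_ofPred_eq, hslice, integral_const, probReal_univ, one_smul] using h

theorem measureReal_le_countIn_eval {R : Finset ι} {j : ι} (hj : j ∉ R) (t : ℝ) :
    (Measure.infinitePi fun _ : ι => ν).real {x | t ≤ countIn R (B (x j)) x} =
      binomialTail v R.card t := by
  have hslice (y : ι → α) : (Measure.infinitePi fun _ : ι => ν).real
      {x | t ≤ countIn R (B (y j)) x} = binomialTail v R.card t := by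
    have hBy : MeasurableSet (B (y j)) := measurable_prodMk_left hB
    rw [measureReal_le_countIn ν R hBy, hv]
  have h := measureReal_prodMk_mem_of_indepFun (measurable_pi_apply j)
    (Finset.measurable_restrict R)
    (indepFun_eval_restrict_infinitePi ν hj) (E := {p | t ≤ countIn Finset.univ (B p.1) p.2})
    (measurable_countIn Finset.univ hB (MeasurableSet.of_discrete (s := {n : ℕ | t ≤ (n : ℝ)})))
  simpa only [Set.mem_ofPred_eq, countIn_restrict, hslice, integral_const, probReal_univ,
    one_smul] using h

theorem measureReal_le_countIn_and_le_countIn_le_of_disjoint {D : α → Set α}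
    (hdisj : ∀ a, ∀ b ∉ D a, Disjoint (B a) (B b)) (R : Finset ι) (t : ℝ) (a b : α) :
    (Measure.infinitePi fun _ : ι => ν).real
        {x | t ≤ countIn R (B a) x ∧ t ≤ countIn R (B b) x} ≤
      binomialTail v R.card t ^ 2 + (D a).indicator (fun _ => binomialTail v R.card t) b := by
  have hBm (a : α) : MeasurableSet (B a) := measurable_prodMk_left hB
  by_cases hb : b ∈ D a
  · rw [Set.indicator_of_mem hb, ← hv a, ← measureReal_le_countIn ν R (hBm a)]
    exact le_add_of_nonneg_of_le (sq_nonneg _) (measureReal_mono fun x hx => hx.1)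
  · rw [Set.indicator_of_notMem hb, add_zero, sq]
    simpa only [hv] using
      measureReal_le_countIn_and_le_countIn_le ν R (hBm a) (hBm b) (hdisj a b hb) t

theorem measureReal_le_countIn_eval_inter_le {D : α → Set α}
    (hD : MeasurableSet {p : α × α | p.2 ∈ D p.1}) {w : ℝ} (hw : ∀ a, ν.real (D a) = w)
    (hdisj : ∀ a, ∀ b ∉ D a, Disjoint (B a) (B b)) {R : Finset ι} {j l : ι} (hj : j ∉ R)
    (hl : l ∉ R) (hjl : j ≠ l) (t : ℝ) :
    (Measure.infinitePi fun _ : ι => ν).real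
        ({x | t ≤ countIn R (B (x j)) x} ∩ {x | t ≤ countIn R (B (x l)) x}) ≤
      binomialTail v R.card t ^ 2 + binomialTail v R.card t * w := by
  classical
  set P := Measure.infinitePi fun _ : ι => ν
  set p := binomialTail v R.card t
  have hpair : Measurable fun x : ι → α => (x j, x l) := by fun_prop
  have hindep : IndepFun (fun x : ι → α => (x j, x l)) R.restrict P :=
    (indepFun_restrict_infinitePi ν (S := {j, l}) (R := R) (by simp [hj, hl])).comp
      (φ := fun z : ({j, l} : Finset ι) → α => (z ⟨j, by simp⟩, z ⟨l, by simp⟩)) (by fun_prop)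
      measurable_id
  have hcount {f : α × α → α} (hf : Measurable f) :
      MeasurableSet {q : (α × α) × (R → α) | t ≤ countIn Finset.univ (B (f q.1)) q.2} :=
    measurable_countIn Finset.univ (B := fun a => B (f a))
      (((hf.comp measurable_fst).prodMk measurable_snd) hB)
      (MeasurableSet.of_discrete (s := {n : ℕ | t ≤ (n : ℝ)}))
  have hdecouple := measureReal_prodMk_mem_of_indepFun hpair (Finset.measurable_restrict R) hindep
    ((hcount measurable_fst).inter (hcount measurable_snd))
  simp only [Set.mem_inter_iff, Set.mem_ofPred_eq, countIn_restrict] at hdecouple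
  have hDm : MeasurableSet {x : ι → α | x l ∈ D (x j)} := hpair hD
  have hint : Integrable ({x : ι → α | x l ∈ D (x j)}.indicator fun _ => p) P :=
    (integrable_const p).indicator hDm
  change P.real {x | t ≤ countIn R (B (x j)) x ∧ t ≤ countIn R (B (x l)) x} ≤ _
  calc _ = _ := hdecouple
    _ ≤ ∫ y, p ^ 2 + {x : ι → α | x l ∈ D (x j)}.indicator (fun _ => p) y ∂P :=
        integral_mono_of_nonneg (Eventually.of_forall fun _ => measureReal_nonneg)
          ((integrable_const _).add hint) (Eventually.of_forall fun y =>
            measureReal_le_countIn_and_le_countIn_le_of_disjoint hB hv hdisj R t (y j) (y l))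
    _ = p ^ 2 + p * w := by
        rw [integral_add (integrable_const _) hint, integral_indicator_const _ hDm,
          measureReal_eval_mem hD hw hjl, smul_eq_mul, mul_comm w]
        simp

end Counting

/-! ### The second moment method -/

theorem memLp_indicator_one {Ω : Type*} [MeasurableSpace Ω] {P : Measure Ω} [IsFiniteMeasure P]
    {A : Set Ω} (hA : MeasurableSet A) : MemLp (A.indicator (1 : Ω → ℝ)) 2 P :=
  memLp_indicator_const 2 hA 1 (Or.inr (measure_ne_top P A))

theorem covariance_indicator_one {Ω : Type*} [MeasurableSpace Ω] {P : Measure Ω}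
    [IsProbabilityMeasure P] {A A' : Set Ω} (hA : MeasurableSet A) (hA' : MeasurableSet A') :
    cov[A.indicator 1, A'.indicator 1; P] = P.real (A ∩ A') - P.real A * P.real A' := by
  rw [covariance_eq_sub (memLp_indicator_one hA) (memLp_indicator_one hA'),
    ← Set.inter_indicator_one, integral_indicator_one (hA.inter hA'), integral_indicator_one hA,
    integral_indicator_one hA']

section SecondMoment

variable {Ω ι : Type*} [MeasurableSpace Ω] {P : Measure Ω} [IsProbabilityMeasure P] {C : Finset ι}
  {A : ι → Set Ω} (hA : ∀ j ∈ C, MeasurableSet (A j)) {p δ : ℝ}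
  (hprob : ∀ j ∈ C, P.real (A j) = p)
include hA hprob

theorem integral_sum_indicator_one :
    ∫ ω, (∑ j ∈ C, (A j).indicator (1 : Ω → ℝ)) ω ∂P = C.card * p := by
  simp only [Finset.sum_apply]
  rw [integral_finsetSum _ fun j hj => (memLp_indicator_one (hA j hj)).integrable one_le_two,
    ← nsmul_eq_mul, ← Finset.sum_const]
  exact Finset.sum_congr rfl fun j hj => (integral_indicator_one (hA j hj)).trans (hprob j hj)

theorem variance_sum_indicator_one_le (hp : 0 ≤ p) (hδ : 0 ≤ δ)
    (hpair : ∀ j ∈ C, ∀ l ∈ C, j ≠ l → P.real (A j ∩ A l) ≤ p ^ 2 + p * δ) :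
    Var[∑ j ∈ C, (A j).indicator (1 : Ω → ℝ); P] ≤ C.card * p + C.card ^ 2 * (p * δ) := by
  classical
  have hcov : ∀ j ∈ C, ∀ l ∈ C, cov[(A j).indicator 1, (A l).indicator 1; P] ≤
      (if j = l then p else 0) + p * δ := fun j hj l hl => by
    rw [covariance_indicator_one (hA j hj) (hA l hl), hprob j hj, hprob l hl]
    split_ifs with h
    · rw [← h, Set.inter_self, hprob j hj]
      nlinarith [mul_nonneg hp hδ]
    · linarith [hpair j hj l hl h]
  rw [variance_sum' fun j hj => memLp_indicator_one (hA j hj)]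
  refine (Finset.sum_le_sum fun j hj => Finset.sum_le_sum (hcov j hj)).trans (le_of_eq ?_)
  simp only [Finset.sum_add_distrib, Finset.sum_ite_eq, Finset.sum_const, nsmul_eq_mul,
    Finset.sum_ite_mem, Finset.inter_self]
  ring

theorem measureReal_forall_notMem_le (hC : C.Nonempty) (hp : 0 < p) (hδ : 0 ≤ δ)
    (hpair : ∀ j ∈ C, ∀ l ∈ C, j ≠ l → P.real (A j ∩ A l) ≤ p ^ 2 + p * δ) :
    P.real {ω | ∀ j ∈ C, ω ∉ A j} ≤ 1 / (C.card * p) + δ / p := by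
  have : (0 : ℝ) < C.card := by exact_mod_cast hC.card_pos
  set Z : Ω → ℝ := ∑ j ∈ C, (A j).indicator 1
  have hsub : {ω | ∀ j ∈ C, ω ∉ A j} ⊆ {ω | C.card * p ≤ |Z ω - ∫ ω, Z ω ∂P|} := fun ω hω => by
    have hZ : Z ω = 0 := by
      simp only [Z, Finset.sum_apply]
      exact Finset.sum_eq_zero fun j hj => Set.indicator_of_notMem (hω j hj) _
    rw [Set.mem_ofPred_eq, integral_sum_indicator_one hA hprob, hZ, zero_sub, abs_neg]
    exact le_abs_self _
  calc P.real {ω | ∀ j ∈ C, ω ∉ A j}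
      ≤ Var[Z; P] / (C.card * p) ^ 2 :=
        ENNReal.toReal_le_of_le_ofReal (div_nonneg (variance_nonneg _ _) (sq_nonneg _))
          ((measure_mono hsub).trans (meas_ge_le_variance_div_sq
            (memLp_finsetSum' _ fun j hj => memLp_indicator_one (hA j hj)) (by positivity)))
    _ ≤ (C.card * p + C.card ^ 2 * (p * δ)) / (C.card * p) ^ 2 := by
        gcongr
        exact variance_sum_indicator_one_le hA hprob hp.le hδ hpair
    _ = 1 / (C.card * p) + δ / p := by field_simp

end SecondMoment

/-! ### Vertex degrees -/

/-- The law of the positions: independent uniform points in the cube. -/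
noncomputable abbrev positionsLaw (d : ℕ) : Measure (ℕ → Cube d) :=
  Measure.infinitePi fun _ => volume

theorem positionsLaw_real_forall_countIn_torusBall_lt_le {d : ℕ} {r : ℝ} (h0 : 0 < r)
    (hr : r < 1 / 4) {C R : Finset ℕ} (hC : C.Nonempty) (hCR : Disjoint C R) {t : ℝ}
    (hp : 0 < binomialTail (torusBallVolume d r) R.card t) :
    (positionsLaw d).real {x | ∀ j ∈ C, countIn R (torusBall r (x j)) x < t} ≤
      1 / (C.card * binomialTail (torusBallVolume d r) R.card t) +
        2 ^ d * torusBallVolume d r / binomialTail (torusBallVolume d r) R.card t := by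
  have hball := measurableSet_torusDist_le (d := d) r
  have hvol (a : Cube d) := volume_torusBall a h0.le (by linarith : r < 1 / 2)
  have hvol₂ (a : Cube d) : volume.real (torusBall (2 * r) a) = 2 ^ d * torusBallVolume d r :=
    (volume_torusBall a (by linarith) (by linarith)).trans (torusBallVolume_two_mul d r)
  have hv := torusBallVolume_pos (d := d) h0
  have hne {j : ℕ} (hj : j ∈ C) : j ∉ R := Finset.disjoint_left.1 hCR hj
  simpa only [Set.mem_ofPred_eq, not_le] using
    measureReal_forall_notMem_le (P := positionsLaw d)
      (A := fun j => {x | t ≤ countIn R (torusBall r (x j)) x})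
      (fun j _ => measurableSet_le measurable_const (measurable_from_top.comp
        ((measurable_countIn R hball).comp ((measurable_pi_apply j).prodMk measurable_id))))
      (fun j hj => measureReal_le_countIn_eval hball hvol (hne hj) t)
      hC hp (δ := 2 ^ d * torusBallVolume d r) (by positivity)
      fun j hj l hl hjl => measureReal_le_countIn_eval_inter_le hball hvol
        (measurableSet_torusDist_le (2 * r)) hvol₂
        (fun a b hab => disjoint_torusBall (not_le.1 hab)) (hne hj) (hne hl) hjl t

theorem positionsLaw_real_le_countIn_torusBall_le {d : ℕ} {r : ℝ} (h0 : 0 < r)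
    (hr : r < 1 / 2) {i : ℕ} {U : Finset ℕ} (hi : i ∉ U) {a s : ℝ} (ha : 0 < a)
    (hs : U.card * torusBallVolume d r + a ≤ s) :
    (positionsLaw d).real {x | s ≤ countIn U (torusBall r (x i)) x} ≤
      U.card * torusBallVolume d r / a ^ 2 := by
  rw [measureReal_le_countIn_eval (measurableSet_torusDist_le r)
    (fun y => volume_torusBall y h0.le hr) hi]
  exact binomialTail_le (torusBallVolume_pos h0).le (torusBallVolume_le_one h0.le hr) _ ha hs

theorem countIn_le_degree_plantedGraph {d : ℕ} {r : ℝ} {ω : Outcome d} {R : Finset ℕ}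
    (hR : R ⊆ Finset.range ω.1) {j : Fin ω.1} (hj : (j : ℕ) ∉ R)
    [Fintype ((plantedGraph r ω).neighborSet j)] :
    countIn R (torusBall r (ω.2.1 j)) ω.2.1 ≤ (plantedGraph r ω).degree j := by
  classical
  rw [← SimpleGraph.card_neighborFinset_eq_degree, ← Finset.card_map Fin.valEmbedding, countIn]
  refine Finset.card_le_card fun l hl => ?_
  obtain ⟨hlR, hlB⟩ := Finset.mem_filter.1 hl
  refine Finset.mem_map.2 ⟨⟨l, Finset.mem_range.1 (hR hlR)⟩, ?_, rfl⟩
  rw [SimpleGraph.mem_neighborFinset]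
  exact Or.inl ⟨fun h => hj (h ▸ hlR), hlB⟩

theorem degree_plantedGraph_le {d : ℕ} {r : ℝ} {ω : Outcome d} (i : Fin ω.1)
    [Fintype ((plantedGraph r ω).neighborSet i)] :
    (plantedGraph r ω).degree i ≤
      countIn ((Finset.range ω.1).erase i) (torusBall r (ω.2.1 i)) ω.2.1 + ω.2.2.card := by
  classical
  rw [← SimpleGraph.card_neighborFinset_eq_degree, ← Finset.card_map Fin.valEmbedding, countIn]
  refine (Finset.card_le_card fun l hl => ?_).trans (Finset.card_union_le _ _)
  obtain ⟨l, hadj, rfl⟩ := Finset.mem_map.1 hl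
  rw [SimpleGraph.mem_neighborFinset] at hadj
  rw [Finset.mem_union, Finset.mem_filter]
  rcases hadj with ⟨hne, hdist⟩ | ⟨-, -, hK⟩
  · exact Or.inl ⟨Finset.mem_erase.2 ⟨fun h => hne (Fin.ext h.symm), Finset.mem_range.2 l.2⟩, hdist⟩
  · exact Or.inr (by simpa [plantedSet] using hK)

theorem mem_vdFails_of_countIn {d k : ℕ} {r s : ℝ} {ω : Outcome d} {R : Finset ℕ} {i j : ℕ}
    (hK : ω.2.2 ⊆ Finset.range ω.1) (hKk : ω.2.2.card ≤ k) (hi : i ∈ ω.2.2)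
    (hj : j ∈ Finset.range ω.1 \ ω.2.2) (hR : R ⊆ Finset.range ω.1) (hjR : j ∉ R)
    (hjs : s + k ≤ countIn R (torusBall r (ω.2.1 j)) ω.2.1)
    (his : countIn ((Finset.range ω.1).erase i) (torusBall r (ω.2.1 i)) ω.2.1 < s) :
    ω ∈ vdFails d r k := by
  classical
  rintro ⟨-, houtput⟩
  obtain ⟨hjN, hjK⟩ := Finset.mem_sdiff.1 hj
  set i' : Fin ω.1 := ⟨i, Finset.mem_range.1 (hK hi)⟩
  set j' : Fin ω.1 := ⟨j, Finset.mem_range.1 hjN⟩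
  have hdeg : (plantedGraph r ω).degree i' < (plantedGraph r ω).degree j' := by
    have hi' := degree_plantedGraph_le (r := r) i'
    have hj' := countIn_le_degree_plantedGraph (r := r) hR (j := j') hjR
    rify at hi' hj' hKk ⊢
    linarith
  exact (houtput i' (by simpa [plantedSet, i'] using hi) j'
    (by simpa [plantedSet, j'] using hjK)).not_gt hdeg

theorem positionsLaw_real_notMem_vdFails_le {d N k : ℕ} {r : ℝ} (h0 : 0 < r) (hr : r < 1 / 4)
    {K C R : Finset ℕ} (hK : K ⊆ Finset.range N) (hKk : K.card ≤ k) (hK0 : K.Nonempty)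
    (hC : C.Nonempty) (hCK : C ⊆ Finset.range N \ K) (hRC : R ⊆ Finset.range N \ C)
    {a s : ℝ} (ha : 0 < a) (hs : N * torusBallVolume d r + a ≤ s)
    (hp : 0 < binomialTail (torusBallVolume d r) R.card (s + k)) :
    (positionsLaw d).real {x | ((N, x, K) : Outcome d) ∉ vdFails d r k} ≤
      1 / (C.card * binomialTail (torusBallVolume d r) R.card (s + k)) +
        2 ^ d * torusBallVolume d r / binomialTail (torusBallVolume d r) R.card (s + k) +
        N * torusBallVolume d r / a ^ 2 := by
  obtain ⟨i, hi⟩ := hK0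
  have hv := torusBallVolume_pos (d := d) h0
  have hCR : Disjoint C R :=
    Finset.disjoint_right.2 fun j hj => (Finset.mem_sdiff.1 (hRC hj)).2
  have hcard : (((Finset.range N).erase i).card : ℝ) ≤ N := by
    exact_mod_cast Finset.card_erase_le.trans (Finset.card_range N).le
  have hcardv := mul_le_mul_of_nonneg_right hcard hv.le
  have hsub : {x | ((N, x, K) : Outcome d) ∉ vdFails d r k} ⊆
      {x | ∀ j ∈ C, countIn R (torusBall r (x j)) x < s + k} ∪
        {x | s ≤ countIn ((Finset.range N).erase i) (torusBall r (x i)) x} := fun x hx => by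
    by_contra h
    simp only [Set.mem_union, not_or, Set.mem_ofPred_eq, not_forall, not_lt, not_le] at h
    obtain ⟨⟨j, hj, hjs⟩, his⟩ := h
    exact hx (mem_vdFails_of_countIn hK hKk hi (hCK hj) (hRC.trans Finset.sdiff_subset)
      (Finset.disjoint_left.1 hCR hj) hjs his)
  refine (measureReal_mono hsub).trans ((measureReal_union_le _ _).trans (add_le_add
    (positionsLaw_real_forall_countIn_torusBall_lt_le h0 hr hC hCR hp) ?_))
  refine (positionsLaw_real_le_countIn_torusBall_le h0 (by linarith) (Finset.notMem_erase i _) ha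
    (by linarith)).trans ?_
  gcongr

/-! ### The joint law -/

theorem measurableSet_geometricGraph_mem {d N : ℕ} (r : ℝ) (S : Set (SimpleGraph (Fin N))) :
    MeasurableSet {x : ℕ → Cube d | geometricGraph r (fun i : Fin N => x i) ∈ S} := by
  have hadj (i j : Fin N) : MeasurableSet
      {x : ℕ → Cube d | (geometricGraph r fun i : Fin N => x i).Adj i j} := by
    have hpair : Measurable fun x : ℕ → Cube d => (x i, x j) := by fun_prop
    exact (MeasurableSet.const (i ≠ j)).inter (hpair (measurableSet_torusDist_le r))
  have hunion : {x : ℕ → Cube d | geometricGraph r (fun i : Fin N => x i) ∈ S} =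
      ⋃ G ∈ S, ⋂ i, ⋂ j, {x | (geometricGraph r fun i : Fin N => x i).Adj i j ↔ G.Adj i j} := by
    ext x
    simp only [Set.mem_ofPred_eq, Set.mem_iUnion, Set.mem_iInter, exists_prop]
    refine ⟨fun hx => ⟨_, hx, fun _ _ => Iff.rfl⟩, fun ⟨G, hG, h⟩ => ?_⟩
    rwa [show geometricGraph r (fun i : Fin N => x i) = G by ext i j; exact h i j]
  rw [hunion]
  exact MeasurableSet.biUnion (Set.to_countable S) fun G _ => MeasurableSet.iInter fun i =>
    MeasurableSet.iInter fun j => (hadj i j).iff (MeasurableSet.const _)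

theorem measurableSet_vdFails (d : ℕ) (r : ℝ) (k : ℕ) : MeasurableSet (vdFails d r k) := by
  have hunion : vdFails d r k = ⋃ N : ℕ, ⋃ K : Finset ℕ,
      {N} ×ˢ ({x | ((N, x, K) : Outcome d) ∈ vdFails d r k} ×ˢ {K}) := by
    ext ⟨N, x, K⟩
    simp
  rw [hunion]
  exact MeasurableSet.iUnion fun N => MeasurableSet.iUnion fun K =>
    (measurableSet_singleton N).prod ((measurableSet_geometricGraph_mem r
      {G | Finset.univ.filter (fun i : Fin N => (i : ℕ) ∈ K) ∉ vdOutputs (plantClique G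
        (Finset.univ.filter fun i : Fin N => (i : ℕ) ∈ K)) k}).prod (measurableSet_singleton K))

theorem ae_cliqueLaw_mem_powersetCard (k N : ℕ) :
    ∀ᵐ K ∂cliqueLaw k N, K ∈ Finset.powersetCard (min k N) (Finset.range N) := by
  have hm : MeasurableSet
      (Finset.powersetCard (min k N) (Finset.range N) : Set (Finset ℕ)) :=
    (Finset.finite_toSet _).measurableSet
  refine (mem_ae_iff_prob_eq_one hm).2 ((PMF.toMeasure_apply_eq_one_iff _ hm).2 ?_)
  rw [PMF.support_uniformOfFinset]

theorem positionsCliqueKernel_apply_le {d k N : ℕ} {E : Set ((ℕ → Cube d) × Finset ℕ)}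
    (hE : MeasurableSet E) {η : ℝ} (h : ∀ K ∈ Finset.powersetCard (min k N) (Finset.range N),
      (positionsLaw d).real {x | (x, K) ∈ E} ≤ η) :
    positionsCliqueKernel d k N E ≤ ENNReal.ofReal η := by
  have hslice : ∀ᵐ K ∂cliqueLaw k N,
      positionsLaw d ((fun x => (x, K)) ⁻¹' E) ≤ ENNReal.ofReal η := by
    filter_upwards [ae_cliqueLaw_mem_powersetCard k N] with K hK
    rw [← ofReal_measureReal]
    exact ENNReal.ofReal_le_ofReal (h K hK)
  calc positionsCliqueKernel d k N E
      = ∫⁻ K, positionsLaw d ((fun x => (x, K)) ⁻¹' E) ∂cliqueLaw k N :=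
        Measure.prod_apply_symm hE
    _ ≤ ∫⁻ _, ENNReal.ofReal η ∂cliqueLaw k N := lintegral_mono_ae hslice
    _ = ENNReal.ofReal η := by simp

theorem plantedLaw_apply_le {d n k : ℕ} {E : Set (Outcome d)} (hE : MeasurableSet E) (I : Set ℕ)
    {η : ℝ} (h : ∀ N ∈ I, ∀ K ∈ Finset.powersetCard (min k N) (Finset.range N),
      (positionsLaw d).real {x | (N, x, K) ∈ E} ≤ η) :
    plantedLaw d n k E ≤ poissonMeasure (n : NNReal) Iᶜ + ENNReal.ofReal η := by
  have hkernel (N : ℕ) : positionsCliqueKernel d k N (Prod.mk N ⁻¹' E) ≤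
      Iᶜ.indicator 1 N + ENNReal.ofReal η := by
    by_cases hN : N ∈ I
    · exact (positionsCliqueKernel_apply_le (measurable_prodMk_left hE) (h N hN)).trans le_add_self
    · rw [Set.indicator_of_mem (by exact hN)]
      exact prob_le_one.trans le_self_add
  rw [plantedLaw, Measure.compProd_apply hE]
  refine (lintegral_mono hkernel).trans_eq ?_
  rw [lintegral_add_right _ measurable_const, lintegral_indicator_one MeasurableSet.of_discrete,
    lintegral_const, measure_univ, mul_one]

/-! ### Concentration of the number of vertices -/

theorem hasSum_poisson_descFactorial (r : NNReal) (j : ℕ) :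
    HasSum (fun n : ℕ => Real.exp (-r) * r ^ n / n.factorial * n.descFactorial j)
      ((r : ℝ) ^ j) := by
  have hshift := (hasSum_one_poissonMeasure r).mul_left ((r : ℝ) ^ j)
  rw [mul_one] at hshift
  rw [← hasSum_nat_add_iff' j, Finset.sum_eq_zero fun n hn => by
    rw [Nat.descFactorial_of_lt (Finset.mem_range.1 hn), Nat.cast_zero, mul_zero], sub_zero]
  refine hshift.congr_fun fun n => ?_
  have hfact : (((n + j).factorial : ℕ) : ℝ) = n.factorial * (n + j).descFactorial j := by
    rw [← Nat.factorial_mul_descFactorial (Nat.le_add_left j n), Nat.add_sub_cancel, Nat.cast_mul]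
  have hpos : (0 : ℝ) < (n + j).descFactorial j := by
    exact_mod_cast Nat.descFactorial_pos.2 (Nat.le_add_left j n)
  rw [hfact, pow_add]
  field_simp

theorem hasSum_poisson_sub_sq (r : NNReal) :
    HasSum (fun n : ℕ => Real.exp (-r) * r ^ n / n.factorial * ((n : ℝ) - r) ^ 2) r := by
  have h := ((hasSum_poisson_descFactorial r 2).add
    ((hasSum_poisson_descFactorial r 1).mul_left (1 - 2 * (r : ℝ)))).add
    ((hasSum_poisson_descFactorial r 0).mul_left ((r : ℝ) ^ 2))
  simp only [Nat.cast_descFactorial_two, Nat.descFactorial_one, Nat.descFactorial_zero,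
    Nat.cast_one] at h
  convert h using 1
  · funext n
    ring
  · ring

theorem poissonMeasure_le_abs_sub_le (r : NNReal) {a : ℝ} (ha : 0 < a) :
    poissonMeasure r {N | a ≤ |(N : ℝ) - r|} ≤ ENNReal.ofReal (r / a ^ 2) := by
  have hsum := hasSum_poisson_sub_sq r
  have hint : Integrable (fun N : ℕ => ((N : ℝ) - r) ^ 2) (poissonMeasure r) :=
    integrable_poissonMeasure_iff.2 (by simpa using hsum.summable)
  have hvar : ∫ N : ℕ, ((N : ℝ) - r) ^ 2 ∂poissonMeasure r = r :=
    (hasSum_integral_poissonMeasure hint).unique hsum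
  have hmarkov := mul_meas_ge_le_integral_of_nonneg
    (Eventually.of_forall fun N : ℕ => sq_nonneg ((N : ℝ) - r)) hint (a ^ 2)
  rw [hvar] at hmarkov
  have hset : {N : ℕ | a ≤ |(N : ℝ) - r|} = {N : ℕ | a ^ 2 ≤ ((N : ℝ) - r) ^ 2} := by
    ext N
    rw [Set.mem_ofPred_eq, Set.mem_ofPred_eq, ← sq_abs ((N : ℝ) - r),
      pow_le_pow_iff_left₀ ha.le (abs_nonneg _) two_ne_zero]
  rw [hset, ← ofReal_measureReal]
  exact ENNReal.ofReal_le_ofReal ((le_div_iff₀' (by positivity)).2 hmarkov)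

/-! ### Failure at a fixed intensity -/

/-- The number of vertices used to count the degrees of the candidates outside the clique: `n`, less
the deviation `L √n` of the Poisson number of vertices and the `⌊v⁻¹⌋₊` candidates. -/
noncomputable def restCard (L : ℝ) (n : ℕ) (v : ℝ) : ℕ := n - ⌈L * √n⌉₊ - ⌊v⁻¹⌋₊

/-- The probability that a candidate at a given position has at least `n v + 3 L √(n v) + k` of
the `restCard L n v` counted vertices in its ball of volume `v`; a fixed clique vertex has a smaller
degree with probability at least `1 - L⁻²`. -/
noncomputable def candidateProb (L : ℝ) (n : ℕ) (v : ℝ) (k : ℕ) : ℝ :=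
  binomialTail v (restCard L n v) (n * v + 3 * L * √(n * v) + k)

theorem restCard_le (L : ℝ) (n : ℕ) (v : ℝ) : restCard L n v ≤ n := by
  unfold restCard
  omega

section RestCard

variable {n : ℕ} {v L : ℝ}

theorem mul_sqrt_le_div_four (hv : v ≤ 1) (hLn : 4 * L ≤ √(n * v)) : L * √n ≤ n / 4 := by
  have hsqrt : √(n * v) ≤ √n := Real.sqrt_le_sqrt (mul_le_of_le_one_right n.cast_nonneg hv)
  nlinarith [Real.mul_self_sqrt (Nat.cast_nonneg (α := ℝ) n), Real.sqrt_nonneg (n : ℝ)]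

variable (hv0 : 0 < v)
include hv0

theorem sixteen_le_mul (hL : 1 ≤ L) (hLn : 4 * L ≤ √(n * v)) : 16 ≤ n * v := by
  nlinarith [Real.mul_self_sqrt (by positivity : 0 ≤ n * v)]

theorem restCard_mul_le : restCard L n v * v ≤ n * v := by
  gcongr
  exact restCard_le L n v

theorem sqrt_mul_le_sqrt_mul (hv : v ≤ 1) : √n * v ≤ √(n * v) := by
  rw [Real.sqrt_mul n.cast_nonneg]
  gcongr
  exact Real.le_sqrt_of_sq_le (by nlinarith)

theorem inv_le_div_sixteen (hL : 1 ≤ L) (hLn : 4 * L ≤ √(n * v)) : v⁻¹ ≤ n / 16 := by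
  rw [inv_le_iff_one_le_mul₀ hv0]
  linarith [sixteen_le_mul hv0 hL hLn]

theorem sub_le_restCard_mul (hv : v ≤ 1) (hL : 1 ≤ L) (hLn : 4 * L ≤ √(n * v)) :
    n * v - 2 * L * √(n * v) ≤ restCard L n v * v := by
  have hceil : (⌈L * √n⌉₊ : ℝ) < L * √n + 1 := Nat.ceil_lt_add_one (by positivity)
  have hfloor : (⌊v⁻¹⌋₊ : ℝ) ≤ v⁻¹ := Nat.floor_le (by positivity)
  have hcard : (n : ℝ) ≤ restCard L n v + ⌈L * √n⌉₊ + ⌊v⁻¹⌋₊ := by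
    have : n ≤ restCard L n v + ⌈L * √n⌉₊ + ⌊v⁻¹⌋₊ := by unfold restCard; omega
    exact_mod_cast this
  have hmul := mul_le_mul_of_nonneg_right
    (by linarith : n - (L * √n + 1) - v⁻¹ ≤ restCard L n v) hv0.le
  rw [sub_mul, sub_mul, inv_mul_cancel₀ hv0.ne'] at hmul
  nlinarith [sqrt_mul_le_sqrt_mul (n := n) hv0 hv]

theorem restCard_add_floor_add_le (hv : v ≤ 1) (hL : 1 ≤ L) (hLn : 4 * L ≤ √(n * v)) :
    restCard L n v + ⌊v⁻¹⌋₊ + L * √n ≤ n := by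
  have hceil : (⌈L * √n⌉₊ : ℝ) < L * √n + 1 := Nat.ceil_lt_add_one (by positivity)
  have hfloor : (⌊v⁻¹⌋₊ : ℝ) ≤ v⁻¹ := Nat.floor_le (by positivity)
  have hle : ⌈L * √n⌉₊ + ⌊v⁻¹⌋₊ ≤ n := by
    have := mul_sqrt_le_div_four hv hLn
    have := inv_le_div_sixteen hv0 hL hLn
    have := sixteen_le_mul hv0 hL hLn
    have : (n : ℝ) * v ≤ n := mul_le_of_le_one_right n.cast_nonneg hv
    rify
    linarith
  have hcard : restCard L n v + ⌊v⁻¹⌋₊ + ⌈L * √n⌉₊ = n := by unfold restCard; omega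
  rify at hcard
  linarith [Nat.le_ceil (L * √n)]

theorem mul_le_of_abs_sub_lt (hv : v ≤ 1) {N : ℕ} (hL : 0 ≤ L) (hN : |(N : ℝ) - n| < L * √n) :
    N * v ≤ n * v + L * √(n * v) := by
  nlinarith [sqrt_mul_le_sqrt_mul (n := n) hv0 hv, (abs_lt.1 hN).2]

theorem mul_div_sq_le_of_abs_sub_lt (hv : v ≤ 1) (hL : 1 ≤ L) (hLn : 4 * L ≤ √(n * v)) {N : ℕ}
    (hN : |(N : ℝ) - n| < L * √n) : N * v / (2 * L * √(n * v)) ^ 2 ≤ 1 / L ^ 2 := by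
  have hμ := sixteen_le_mul hv0 hL hLn
  have hn0 : (0 : ℝ) < n := pos_of_mul_pos_left (by linarith) hv0.le
  have hLsqrt : L * √(n * v) ≤ n * v := by
    nlinarith [Real.mul_self_sqrt (by positivity : 0 ≤ n * v)]
  calc N * v / (2 * L * √(n * v)) ^ 2 ≤ 4 * (n * v) / (2 * L * √(n * v)) ^ 2 := by
        gcongr ?_ / _
        linarith [mul_le_of_abs_sub_lt hv0 hv (by linarith) hN]
    _ = 1 / L ^ 2 := by
        rw [mul_pow, mul_pow, Real.sq_sqrt (by positivity)]
        field_simp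
        norm_num

theorem inv_div_two_le_floor_inv (hv : v ≤ 1 / 2) : v⁻¹ / 2 ≤ ⌊v⁻¹⌋₊ := by
  have : 2 ≤ v⁻¹ := by rw [le_inv_comm₀ two_pos hv0]; linarith
  linarith [Nat.sub_one_lt_floor v⁻¹]

end RestCard

section FixedIntensity

variable {d n k : ℕ} {r L : ℝ} (h0 : 0 < r) (hr : r < 1 / 4)
  (hv : torusBallVolume d r ≤ 1 / 2) (hL : 1 ≤ L) (hLn : 4 * L ≤ √(n * torusBallVolume d r))
  (hk : 1 ≤ k) (hkn : (k : ℝ) ≤ n / 2)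
include h0 hv hL hLn hkn

theorem exists_candidates {N : ℕ} (hN : |(N : ℝ) - n| < L * √n) {K : Finset ℕ}
    (hK : K ⊆ Finset.range N) (hKk : K.card ≤ k) :
    ∃ C ⊆ Finset.range N \ K, ∃ R ⊆ Finset.range N \ C,
      C.card = ⌊(torusBallVolume d r)⁻¹⌋₊ ∧ R.card = restCard L n (torusBallVolume d r) := by
  have hv0 := torusBallVolume_pos (d := d) h0
  have hNn := (abs_lt.1 hN).1
  have hLsqrt := mul_sqrt_le_div_four (hv.trans (by norm_num)) hLn
  have hfloor := Nat.floor_le (inv_nonneg.2 hv0.le)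
  have hinv := inv_le_div_sixteen hv0 hL hLn
  obtain ⟨C, hCK, hC⟩ : ∃ C ⊆ Finset.range N \ K, C.card = ⌊(torusBallVolume d r)⁻¹⌋₊ := by
    refine Finset.exists_subset_card_eq ?_
    rw [Finset.card_sdiff_of_subset hK, Finset.card_range]
    refine Nat.le_sub_of_add_le ?_
    rify at hKk ⊢
    linarith [(Nat.cast_nonneg n : (0 : ℝ) ≤ n)]
  refine ⟨C, hCK, ?_⟩
  obtain ⟨R, hRC, hR⟩ : ∃ R ⊆ Finset.range N \ C,
      R.card = restCard L n (torusBallVolume d r) := by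
    refine Finset.exists_subset_card_eq ?_
    rw [Finset.card_sdiff_of_subset (hCK.trans Finset.sdiff_subset), Finset.card_range, hC]
    refine Nat.le_sub_of_add_le ?_
    have := restCard_add_floor_add_le hv0 (hv.trans (by norm_num)) hL hLn
    rify
    linarith
  exact ⟨R, hRC, hC, hR⟩

include hr hk in
theorem positionsLaw_real_notMem_vdFails_le_of_abs_sub_lt
    (hp : 0 < candidateProb L n (torusBallVolume d r) k) {N : ℕ} (hN : |(N : ℝ) - n| < L * √n)
    {K : Finset ℕ} (hK : K ∈ Finset.powersetCard (min k N) (Finset.range N)) :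
    (positionsLaw d).real {x | ((N, x, K) : Outcome d) ∉ vdFails d r k} ≤
      1 / L ^ 2 +
        (2 + 2 ^ d) * (torusBallVolume d r / candidateProb L n (torusBallVolume d r) k) := by
  have hv0 := torusBallVolume_pos (d := d) h0
  obtain ⟨hKN, hKcard⟩ := Finset.mem_powersetCard.1 hK
  have hKk : K.card ≤ k := hKcard.trans_le (min_le_left _ _)
  obtain ⟨C, hCK, R, hRC, hC, hR⟩ := exists_candidates h0 hv hL hLn hkn hN hKN hKk
  set v := torusBallVolume d r
  set p := candidateProb L n v k
  have hv1 : v ≤ 1 := hv.trans (by norm_num)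
  have hNpos : 0 < N := by
    have := mul_sqrt_le_div_four hv1 hLn
    have hn0 : (0 : ℝ) < n := pos_of_mul_pos_left (by linarith [sixteen_le_mul hv0 hL hLn]) hv0.le
    rify
    linarith [(abs_lt.1 hN).1]
  have hCv : v⁻¹ / 2 ≤ C.card := hC ▸ inv_div_two_le_floor_inv hv0 hv
  have hC0 : C.Nonempty := by
    rw [← Finset.card_pos]
    rify
    linarith [inv_pos.2 hv0]
  have hNv := mul_le_of_abs_sub_lt hv0 hv1 (by linarith) hN
  have hsqrt : 0 < √(n * v) := by linarith
  have hbound := positionsLaw_real_notMem_vdFails_le h0 hr hKN hKk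
    (Finset.card_pos.1 (by omega)) hC0 hCK hRC (a := 2 * L * √(n * v))
    (s := n * v + 3 * L * √(n * v)) (by positivity) (by linarith)
    (by rwa [hR])
  rw [hR] at hbound
  change _ ≤ 1 / (C.card * p) + 2 ^ d * v / p + N * v / (2 * L * √(n * v)) ^ 2 at hbound
  have hcandidate : 1 / (C.card * p) ≤ 2 * (v / p) := by
    calc 1 / (C.card * p) ≤ 1 / (v⁻¹ / 2 * p) := by gcongr
      _ = 2 * (v / p) := by field_simp
  have hclique := mul_div_sq_le_of_abs_sub_lt hv0 hv1 hL hLn hN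
  calc _ ≤ _ := hbound
    _ ≤ 2 * (v / p) + 2 ^ d * v / p + 1 / L ^ 2 := by gcongr
    _ = 1 / L ^ 2 + (2 + 2 ^ d) * (v / p) := by ring

include hr hk in
theorem plantedLaw_compl_vdFails_le (hp : 0 < candidateProb L n (torusBallVolume d r) k) :
    plantedLaw d n k (vdFails d r k)ᶜ ≤
      ENNReal.ofReal (2 / L ^ 2 +
        (2 + 2 ^ d) * (torusBallVolume d r / candidateProb L n (torusBallVolume d r) k)) := by
  have hv0 := torusBallVolume_pos (d := d) h0
  have hn0 : (0 : ℝ) < n :=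
    pos_of_mul_pos_left (by linarith [sixteen_le_mul hv0 hL hLn]) hv0.le
  set v := torusBallVolume d r
  set p := candidateProb L n v k
  have hdev : poissonMeasure (n : NNReal) {N : ℕ | |(N : ℝ) - n| < L * √n}ᶜ ≤
      ENNReal.ofReal (1 / L ^ 2) := by
    have h := poissonMeasure_le_abs_sub_le (n : NNReal) (a := L * √n) (by positivity)
    have hdiv : (n : ℝ) / (L * √n) ^ 2 = 1 / L ^ 2 := by
      rw [mul_pow, Real.sq_sqrt hn0.le]
      field_simp
    rw [NNReal.coe_natCast, hdiv] at h
    simpa only [Set.compl_ofPred, not_lt] using h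
  calc plantedLaw d n k (vdFails d r k)ᶜ
      ≤ poissonMeasure (n : NNReal) {N : ℕ | |(N : ℝ) - n| < L * √n}ᶜ +
          ENNReal.ofReal (1 / L ^ 2 + (2 + 2 ^ d) * (v / p)) :=
        plantedLaw_apply_le (measurableSet_vdFails d r k).compl _ fun N hN K hK =>
          positionsLaw_real_notMem_vdFails_le_of_abs_sub_lt h0 hr hv hL hLn hk hkn hp hN hK
    _ ≤ ENNReal.ofReal (1 / L ^ 2) +
          ENNReal.ofReal (1 / L ^ 2 + (2 + 2 ^ d) * (v / p)) := by gcongr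
    _ = _ := by
        rw [← ENNReal.ofReal_add (by positivity) (by positivity)]
        congr 1
        ring

end FixedIntensity

/-! ### Binomial tails at the scales of the two regimes -/

theorem entropyH_nonneg {x : ℝ} (hx : 1 ≤ x) : 0 ≤ entropyH x := entropyH_bijOn.mapsTo hx

theorem entropyH_le_sq {x : ℝ} (hx : 0 < x) : entropyH x ≤ (x - 1) ^ 2 := by
  unfold entropyH
  nlinarith [Real.log_le_sub_one_of_pos hx]

theorem exp_le_binomialTail_of_le_add_mul_sqrt {p c : ℝ} (hp0 : 0 < p) (hp : p ≤ 1 / 4) (hc : 0 ≤ c)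
    {n : ℕ} {l t : ℝ} (hl : l = n * p) (hl4 : 4 ≤ l) (hcl : c ≤ √l) (ht : t ≤ l + (c - 3) * √l) :
    3 / 4 * Real.exp (-(2 * c ^ 2 + 6 * c)) ≤ binomialTail p n t := by
  have hsq : √l * √l = l := Real.mul_self_sqrt (by linarith)
  have hsqrt : 0 < √l := Real.sqrt_pos.2 (by linarith)
  set x := 1 + c / √l with hx
  have hxl : (x - 1) * √l = c := by rw [hx, add_sub_cancel_left, div_mul_cancel₀ _ hsqrt.ne']
  have hx1 : 0 ≤ x - 1 := by rw [hx, add_sub_cancel_left]; positivity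
  have hx2 : x ≤ 2 := by nlinarith
  have hsqrtx : √(x * l) ≤ 3 / 2 * √l := by
    rw [Real.sqrt_le_left (by positivity)]
    nlinarith
  have hsq_c : (x - 1) ^ 2 * l = c ^ 2 := by rw [← hxl, mul_pow, Real.sq_sqrt (by linarith)]
  refine le_trans ?_
    (exp_entropyH_le_binomialTail (x := x) hp0 (by linarith) (by nlinarith) hl hl4 (t := t) ?_)
  · gcongr 3 / 4 * Real.exp (-?_)
    have hH : l * entropyH x ≤ c ^ 2 := by
      rw [← hsq_c, mul_comm]
      gcongr
      exact entropyH_le_sq (by linarith)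
    have hs : (x - 1) * √(x * l) ≤ 3 / 2 * c := by
      calc (x - 1) * √(x * l) ≤ (x - 1) * (3 / 2 * √l) := by gcongr
        _ = 3 / 2 * c := by rw [← hxl]; ring
    have hq : 2 * p * (x - 1) ^ 2 * l ≤ c ^ 2 := by
      rw [mul_assoc, hsq_c]
      nlinarith [sq_nonneg c]
    linarith
  · nlinarith

theorem exp_le_binomialTail_of_le_mul {p a : ℝ} (hp : 0 < p) (ha : 1 ≤ a) (hap : a * p ≤ 1 / 2)
    {n : ℕ} {l m t : ℝ} (hl : l = n * p) (hl4 : 4 ≤ l) (hlm : l ≤ m) (hpm : p * m ≤ √m)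
    (ht : t ≤ a * l - 2 * a * √m) :
    3 / 4 * Real.exp (-(m * entropyH a + 6 * a ^ 2 * √m)) ≤ binomialTail p n t := by
  have hsqrt : √(a * l) ≤ a * √m := by
    calc √(a * l) ≤ √(a ^ 2 * m) := by gcongr; nlinarith
      _ = a * √m := by rw [Real.sqrt_mul (by positivity), Real.sqrt_sq (by linarith)]
  refine le_trans ?_ (exp_entropyH_le_binomialTail hp ha hap hl hl4 (t := t) (by linarith))
  gcongr 3 / 4 * Real.exp (-?_)
  have hH : l * entropyH a ≤ m * entropyH a := by
    gcongr
    exact entropyH_nonneg ha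
  have hs : 4 * (a - 1) * √(a * l) ≤ 4 * (a - 1) * (a * √m) := by gcongr
  have hq : 2 * p * (a - 1) ^ 2 * l ≤ 2 * (a - 1) ^ 2 * √m := by
    have := mul_le_mul_of_nonneg_left hlm hp.le
    nlinarith [sq_nonneg (a - 1)]
  nlinarith [mul_nonneg (by linarith : 0 ≤ 8 * a - 2) (Real.sqrt_nonneg m)]

/-! ### Asymptotics -/

theorem tendsto_atTop_of_le_div_log {μ : ℕ → ℝ} {c : ℝ} (hc : 0 < c)
    (h : ∀ᶠ n : ℕ in atTop, c ≤ μ n / Real.log n) : Tendsto μ atTop atTop := by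
  have hlog : Tendsto (fun n : ℕ => Real.log n) atTop atTop :=
    Real.tendsto_log_atTop.comp tendsto_natCast_atTop_atTop
  refine tendsto_atTop_mono' _ ?_ (hlog.const_mul_atTop hc)
  filter_upwards [h, hlog.eventually_gt_atTop 0] with n hn hn0
  exact (le_div_iff₀ hn0).1 hn

theorem isLittleO_sqrt_id_atTop : (fun x : ℝ => √x) =o[atTop] (id : ℝ → ℝ) := by
  refine isLittleO_of_tendsto (fun x (hx : x = 0) => hx ▸ Real.sqrt_zero) ?_
  simpa only [id_eq, Real.sqrt_div_self', one_div, Function.comp_def] using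
    tendsto_inv_atTop_zero.comp Real.tendsto_sqrt_atTop

section LogScale

variable {μ : ℕ → ℝ} {α : ℝ} (hα : 0 < α)
  (hμ : Tendsto (fun n => μ n / Real.log n) atTop (𝓝 α))
include hα hμ

theorem tendsto_comp_div_log {f : ℝ → ℝ} (hf : f =o[atTop] (id : ℝ → ℝ)) :
    Tendsto (fun n => f (μ n) / Real.log n) atTop (𝓝 0) := by
  have hμtop : Tendsto μ atTop atTop :=
    tendsto_atTop_of_le_div_log (half_pos hα) (hμ.eventually_const_le (half_lt_self hα))
  have hμlog : μ =O[atTop] fun n : ℕ => Real.log n := by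
    refine isBigO_of_div_tendsto_nhds ?_ α hμ
    filter_upwards [eventually_gt_atTop 1] with n hn h
    exact absurd h (Real.log_pos (by exact_mod_cast hn)).ne'
  exact ((hf.comp_tendsto hμtop).trans_isBigO hμlog).tendsto_div_nhds_zero

theorem tendsto_div_mul_exp_zero {h : ℝ} (hh : α * h < 1) (D : ℝ) :
    Tendsto (fun n => μ n / n * Real.exp (μ n * h + D * √(μ n))) atTop (𝓝 0) := by
  have hμtop : Tendsto μ atTop atTop :=
    tendsto_atTop_of_le_div_log (half_pos hα) (hμ.eventually_const_le (half_lt_self hα))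
  have hlog : Tendsto (fun n : ℕ => Real.log n) atTop atTop :=
    Real.tendsto_log_atTop.comp tendsto_natCast_atTop_atTop
  have hratio : Tendsto (fun n => 1 - (μ n / Real.log n * h + D * (√(μ n) / Real.log n) +
      Real.log (μ n) / Real.log n)) atTop (𝓝 (1 - (α * h + D * 0 + 0))) :=
    (((hμ.mul_const h).add ((tendsto_comp_div_log hα hμ isLittleO_sqrt_id_atTop).const_mul D)).add
      (tendsto_comp_div_log hα hμ Real.isLittleO_log_id_atTop)).const_sub 1
  refine (Real.tendsto_exp_neg_atTop_nhds_zero.comp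
    (hlog.atTop_mul_pos (by linarith) hratio)).congr' ?_
  filter_upwards [hlog.eventually_gt_atTop 0, hμtop.eventually_gt_atTop 0, eventually_gt_atTop 0]
    with n hn hμn hn0
  have hexp : Real.log n * (1 - (μ n / Real.log n * h + D * (√(μ n) / Real.log n) +
      Real.log (μ n) / Real.log n)) =
      Real.log n - Real.log (μ n) - (μ n * h + D * √(μ n)) := by
    field_simp
    ring
  rw [Function.comp_apply, hexp, neg_sub, sub_eq_add_neg, neg_sub, add_comm, Real.exp_add,
    Real.exp_sub, Real.exp_log hμn, Real.exp_log (by exact_mod_cast hn0)]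

end LogScale

section CandidateProb

theorem exp_le_candidateProb_of_le_mul_sqrt {v : ℝ} {n k : ℕ} {L C : ℝ} (hv0 : 0 < v)
    (hv : v ≤ 1 / 4) (hL : 1 ≤ L) {c : ℝ} (hc : c = 2 * (5 * L + C) + 3) (hC : 0 ≤ C)
    (hcn : 2 * c ≤ √(n * v)) (hk : k ≤ C * √(n * v)) :
    3 / 4 * Real.exp (-(2 * c ^ 2 + 6 * c)) ≤ candidateProb L n v k := by
  have hsq : √(n * v) * √(n * v) = n * v := Real.mul_self_sqrt (by positivity)
  have hl := sub_le_restCard_mul (n := n) hv0 (by linarith) hL (by linarith)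
  have hsqrt : √(n * v) / 2 ≤ √(restCard L n v * v) := Real.le_sqrt_of_sq_le (by nlinarith)
  refine exp_le_binomialTail_of_le_add_mul_sqrt hv0 hv (by linarith) rfl (by nlinarith)
    (by linarith) ?_
  nlinarith

theorem exp_le_candidateProb_of_le_mul {v : ℝ} {n k : ℕ} {L a b : ℝ} (hv0 : 0 < v) (hL : 1 ≤ L)
    (hLn : 4 * L ≤ √(n * v)) (ha : 1 ≤ a) (hv : v * (√(n * v) + 1) ≤ 1 / (2 * a))
    (hab : 3 * L + 2 * a * L + 2 * a ≤ √(n * v) * (a - b)) (hk : k ≤ (b - 1) * (n * v)) :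
    3 / 4 * Real.exp (-(n * v * entropyH a + 6 * a ^ 2 * √(n * v))) ≤ candidateProb L n v k := by
  have hsq : √(n * v) * √(n * v) = n * v := Real.mul_self_sqrt (by positivity)
  have hvsqrt : 0 ≤ v * √(n * v) := by positivity
  have hav : a * (v * (√(n * v) + 1)) ≤ 1 / 2 := by
    calc a * (v * (√(n * v) + 1)) ≤ a * (1 / (2 * a)) := by gcongr
      _ = 1 / 2 := by field_simp
  have hvsqrt1 : v * √(n * v) ≤ 1 := by nlinarith
  have hl := sub_le_restCard_mul (n := n) hv0 (by nlinarith) hL hLn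
  refine exp_le_binomialTail_of_le_mul hv0 ha (by nlinarith) rfl (by nlinarith)
    (restCard_mul_le hv0) (by nlinarith) ?_
  have hal := mul_le_mul_of_nonneg_left hl (by linarith : 0 ≤ a)
  have hmargin := mul_le_mul_of_nonneg_right hab (Real.sqrt_nonneg (n * v))
  rw [mul_right_comm (√_), hsq] at hmargin
  linarith

variable {v : ℕ → ℝ} (hv0 : ∀ n, 0 < v n) {k : ℕ → ℕ} {L : ℝ} (hL : 1 ≤ L)
include hv0 hL

theorem isLittleO_candidateProb_of_isBigO_sqrt (hv : Tendsto v atTop (𝓝 0))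
    (hμ : Tendsto (fun n => n * v n) atTop atTop)
    (hk : (fun n => (k n : ℝ)) =O[atTop] fun n => √(n * v n)) :
    v =o[atTop] fun n => candidateProb L n (v n) (k n) := by
  obtain ⟨C, hC, hkC⟩ := hk.exists_pos
  set c := 2 * (5 * L + C) + 3 with hc
  set δ := 3 / 4 * Real.exp (-(2 * c ^ 2 + 6 * c))
  have hbound : (fun _ => δ) =O[atTop] fun n => candidateProb L n (v n) (k n) := by
    refine IsBigO.of_bound' ?_
    filter_upwards [hv.eventually_le_const (by norm_num : (0 : ℝ) < 1 / 4),
      (Real.tendsto_sqrt_atTop.comp hμ).eventually_ge_atTop (2 * c), hkC.bound]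
      with n hvn hcn hkn
    rw [Real.norm_of_nonneg (Nat.cast_nonneg _), Real.norm_of_nonneg (Real.sqrt_nonneg _)] at hkn
    rw [Real.norm_of_nonneg (by positivity)]
    exact (exp_le_candidateProb_of_le_mul_sqrt (hv0 n) hvn hL hc hC.le hcn hkn).trans
      (Real.le_norm_self _)
  exact ((isLittleO_const_iff (by positivity : δ ≠ 0)).2 hv).trans_isBigO hbound

theorem isLittleO_candidateProb_of_tendsto_div_log {α a b : ℝ} (hα : 0 < α)
    (hμα : Tendsto (fun n => n * v n / Real.log n) atTop (𝓝 α))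
    (ha : 1 ≤ a) (hαa : α * entropyH a < 1) (hba : b < a)
    (hk : ∀ᶠ n : ℕ in atTop, (k n : ℝ) ≤ (b - 1) * (n * v n)) :
    v =o[atTop] fun n => candidateProb L n (v n) (k n) := by
  have hμ : Tendsto (fun n => n * v n) atTop atTop :=
    tendsto_atTop_of_le_div_log (half_pos hα) (hμα.eventually_const_le (half_lt_self hα))
  have hsqrt := Real.tendsto_sqrt_atTop.comp hμ
  have hdiv : ∀ᶠ n : ℕ in atTop, n * v n / n = v n := by
    filter_upwards [eventually_gt_atTop 0] with n hn
    exact mul_div_cancel_left₀ _ (by exact_mod_cast hn.ne')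
  have hv : Tendsto (fun n => v n * Real.exp (√(n * v n))) atTop (𝓝 0) := by
    refine (tendsto_div_mul_exp_zero hα hμα (h := 0) (by linarith) 1).congr' ?_
    filter_upwards [hdiv] with n hn
    rw [hn, mul_zero, zero_add, one_mul]
  have hexp : v =o[atTop] fun n =>
      3 / 4 * Real.exp (-(n * v n * entropyH a + 6 * a ^ 2 * √(n * v n))) := by
    refine (isLittleO_of_tendsto (fun n h => absurd h (Real.exp_ne_zero _)) ?_).const_mul_right
      (by norm_num)
    refine (tendsto_div_mul_exp_zero hα hμα hαa (6 * a ^ 2)).congr' ?_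
    filter_upwards [hdiv] with n hn
    rw [hn, Real.exp_neg, div_inv_eq_mul]
  refine hexp.trans_isBigO (IsBigO.of_bound' ?_)
  filter_upwards [hk, hv.eventually_le_const (by positivity : 0 < 1 / (2 * a)),
    hsqrt.eventually_ge_atTop (4 * L),
    hsqrt.eventually_ge_atTop ((3 * L + 2 * a * L + 2 * a) / (a - b))] with n hkn hvn hLn hn
  rw [Real.norm_of_nonneg (by positivity)]
  refine (exp_le_candidateProb_of_le_mul (hv0 n) hL hLn ha ?_
    ((div_le_iff₀ (by linarith)).1 hn) hkn).trans (Real.le_norm_self _)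
  calc v n * (√(n * v n) + 1) ≤ v n * Real.exp (√(n * v n)) :=
        mul_le_mul_of_nonneg_left (Real.add_one_le_exp _) (hv0 n).le
    _ ≤ 1 / (2 * a) := hvn

end CandidateProb

theorem strictMonoOn_entropyH : StrictMonoOn entropyH (Set.Ici 1) := by
  apply strictMonoOn_of_deriv_pos (convex_Ici 1)
  · exact ((continuous_const.sub continuous_id).add Real.continuous_mul_log).continuousOn
  · intro x hx
    rw [interior_Ici, Set.mem_Ioi] at hx
    have hderiv : HasDerivAt entropyH (0 - 1 + (Real.log x + 1)) x :=
      ((hasDerivAt_const x 1).sub (hasDerivAt_id x)).add (Real.hasDerivAt_mul_log (by linarith))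
    rw [hderiv.deriv]
    linarith [Real.log_pos hx]

theorem one_lt_entropyInv {y : ℝ} (hy : 0 < y) : 1 < entropyInv y := by
  obtain ⟨h1, hH⟩ := entropyInv_spec hy.le
  refine lt_of_le_of_ne h1 fun h => hy.ne ?_
  simpa [← h, entropyH] using hH

theorem exists_between_mul_entropyH_lt_one {α b : ℝ} (hα : 0 < α) (hb : b < entropyInv α⁻¹) :
    ∃ a, 1 ≤ a ∧ b < a ∧ α * entropyH a < 1 := by
  have hc := one_lt_entropyInv (inv_pos.2 hα)
  obtain ⟨a, hba, hac⟩ := exists_between (max_lt hc hb)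
  obtain ⟨ha, hba⟩ := max_lt_iff.1 hba
  refine ⟨a, ha.le, hba, ?_⟩
  have hH := strictMonoOn_entropyH ha.le hc.le hac
  rw [(entropyInv_spec (inv_pos.2 hα).le).2] at hH
  calc α * entropyH a < α * α⁻¹ := by gcongr
    _ = 1 := mul_inv_cancel₀ hα.ne'

theorem tendsto_torusBallVolume_zero {d : ℕ} {r : ℕ → ℝ}
    (hμn : (fun n => meanDegree d n (r n)) =o[atTop] fun n => (n : ℝ)) :
    Tendsto (fun n => torusBallVolume d (r n)) atTop (𝓝 0) := by
  refine hμn.tendsto_div_nhds_zero.congr' ?_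
  filter_upwards [eventually_gt_atTop 0] with n hn
  rw [meanDegree_eq_mul_torusBallVolume, mul_div_cancel_left₀ _ (by exact_mod_cast hn.ne')]

section Regimes

variable {d : ℕ} {r : ℕ → ℝ} (hr : ∀ n, 0 < r n ∧ r n < 1 / 4) {k : ℕ → ℕ} (hk : ∀ n, 1 ≤ k n)
include hr hk

theorem tendsto_plantedLaw_vdFails
    (hμ : Tendsto (fun n => meanDegree d n (r n)) atTop atTop)
    (hv : Tendsto (fun n => torusBallVolume d (r n)) atTop (𝓝 0))
    (hkn : (fun n => (k n : ℝ)) =o[atTop] fun n => (n : ℝ))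
    (hp : ∀ L, 1 ≤ L → (fun n => torusBallVolume d (r n)) =o[atTop]
      fun n => candidateProb L n (torusBallVolume d (r n)) (k n)) :
    Tendsto (fun n => plantedLaw d n (k n) (vdFails d (r n) (k n))) atTop (𝓝 1) := by
  simp only [meanDegree_eq_mul_torusBallVolume] at hμ
  set v := fun n => torusBallVolume d (r n)
  have hcompl : Tendsto (fun n => plantedLaw d n (k n) (vdFails d (r n) (k n))ᶜ) atTop (𝓝 0) := by
    refine ENNReal.tendsto_nhds_zero.2 fun δ hδ => ?_
    have hL0 : Tendsto (fun L : ℝ => ENNReal.ofReal (2 / L ^ 2)) atTop (𝓝 0) := by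
      simpa using ENNReal.tendsto_ofReal (tendsto_const_nhds (x := (2 : ℝ)).div_atTop
        (tendsto_pow_atTop two_ne_zero))
    obtain ⟨L, hLδ, hL⟩ := ((hL0.eventually_lt_const hδ).and (eventually_ge_atTop 1)).exists
    have hbound := ENNReal.tendsto_ofReal
      (((hp L hL).tendsto_div_nhds_zero.const_mul (2 + 2 ^ d : ℝ)).const_add (2 / L ^ 2))
    rw [mul_zero, add_zero] at hbound
    filter_upwards [hbound.eventually_le_const hLδ, (hp L hL).bound one_pos,
      hv.eventually_le_const (by norm_num : (0 : ℝ) < 1 / 2),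
      (Real.tendsto_sqrt_atTop.comp hμ).eventually_ge_atTop (4 * L),
      hkn.bound (by norm_num : (0 : ℝ) < 1 / 2)] with n hδn hvp hvn hLn hkn
    have hv0 : 0 < v n := torusBallVolume_pos (hr n).1
    have hpn : 0 < candidateProb L n (v n) (k n) := by
      refine (binomialTail_nonneg hv0.le (hvn.trans (by norm_num)) _ _).lt_of_ne' ?_
      rw [one_mul] at hvp
      exact norm_pos_iff.1 ((norm_pos_iff.2 hv0.ne').trans_le hvp)
    rw [Real.norm_of_nonneg (Nat.cast_nonneg _), Real.norm_of_nonneg (Nat.cast_nonneg _)] at hkn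
    exact (plantedLaw_compl_vdFails_le (hr n).1 (hr n).2 hvn hL hLn (hk n) (by linarith)
      hpn).trans hδn
  have hfails :=
    ENNReal.Tendsto.sub (tendsto_const_nhds (x := 1)) hcompl (Or.inl ENNReal.one_ne_top)
  rw [tsub_zero] at hfails
  refine hfails.congr fun n => ?_
  rw [prob_compl_eq_one_sub (measurableSet_vdFails d (r n) (k n)),
    ENNReal.sub_sub_cancel ENNReal.one_ne_top prob_le_one]

theorem tendsto_plantedLaw_vdFails_of_isBigO_sqrt
    (hμ : Tendsto (fun n => meanDegree d n (r n)) atTop atTop)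
    (hμn : (fun n => meanDegree d n (r n)) =o[atTop] fun n => (n : ℝ))
    (hkμ : (fun n => (k n : ℝ)) =O[atTop] fun n => √(meanDegree d n (r n))) :
    Tendsto (fun n => plantedLaw d n (k n) (vdFails d (r n) (k n))) atTop (𝓝 1) := by
  have hv := tendsto_torusBallVolume_zero hμn
  have hkn := (hkμ.trans_isLittleO (isLittleO_sqrt_id_atTop.comp_tendsto hμ)).trans hμn
  refine tendsto_plantedLaw_vdFails hr hk hμ hv hkn fun L hL => ?_
  simp only [meanDegree_eq_mul_torusBallVolume] at hμ hkμ
  exact isLittleO_candidateProb_of_isBigO_sqrt (fun n => torusBallVolume_pos (hr n).1) hL hv hμ hkμ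

theorem tendsto_plantedLaw_vdFails_of_tendsto_div_log {α ε : ℝ} (hα : 0 < α) (hε : 0 < ε)
    (hμα : Tendsto (fun n => meanDegree d n (r n) / Real.log n) atTop (𝓝 α))
    (hkα : ∀ᶠ n in atTop, (k n : ℝ) ≤
      (1 - ε) * (maxDegreeScale (meanDegree d n (r n)) α - meanDegree d n (r n))) :
    Tendsto (fun n => plantedLaw d n (k n) (vdFails d (r n) (k n))) atTop (𝓝 1) := by
  set c := entropyInv α⁻¹
  have hc1 : 1 < c := one_lt_entropyInv (inv_pos.2 hα)
  set b := 1 + (1 - ε) * (c - 1) with hb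
  have hkb : ∀ᶠ n in atTop, (k n : ℝ) ≤ (b - 1) * meanDegree d n (r n) := by
    filter_upwards [hkα] with n hn
    calc (k n : ℝ) ≤ _ := hn
      _ = (b - 1) * meanDegree d n (r n) := by rw [maxDegreeScale]; ring
  obtain ⟨a, ha, hba, hαa⟩ :=
    exists_between_mul_entropyH_lt_one (b := b) hα (by rw [hb]; nlinarith)
  have hμ : Tendsto (fun n => meanDegree d n (r n)) atTop atTop :=
    tendsto_atTop_of_le_div_log (half_pos hα) (hμα.eventually_const_le (half_lt_self hα))
  have hμn : (fun n => meanDegree d n (r n)) =o[atTop] fun n => (n : ℝ) := by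
    refine isLittleO_of_tendsto' ?_ ?_
    · filter_upwards [eventually_gt_atTop 0] with n hn h
      exact absurd h (by exact_mod_cast hn.ne')
    · simpa using tendsto_div_mul_exp_zero hα hμα (h := 0) (by linarith) 0
  have hkμ : (fun n => (k n : ℝ)) =O[atTop] fun n => meanDegree d n (r n) := by
    refine IsBigO.of_bound (b - 1) ?_
    filter_upwards [hkb, hμ.eventually_ge_atTop 0] with n hn hμ0
    rwa [Real.norm_of_nonneg (Nat.cast_nonneg _), Real.norm_of_nonneg hμ0]
  refine tendsto_plantedLaw_vdFails hr hk hμ (tendsto_torusBallVolume_zero hμn)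
    (hkμ.trans_isLittleO hμn) fun L hL => ?_
  simp only [meanDegree_eq_mul_torusBallVolume] at hμα hkb
  exact isLittleO_candidateProb_of_tendsto_div_log (fun n => torusBallVolume_pos (hr n).1) hL hα hμα
    ha hαa hba hkb

end Regimes

theorem theorem3_general {d : ℕ} {r : ℕ → ℝ} (hr : ∀ n, 0 < r n ∧ r n < 1 / 4)
    {k : ℕ → ℕ} (hk : ∀ n, 1 ≤ k n)
    (h : (∃ α ε : ℝ, 0 < α ∧ 0 < ε ∧
            Tendsto (fun n => meanDegree d n (r n) / Real.log n) atTop (𝓝 α) ∧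
            ∀ᶠ n in atTop, (k n : ℝ) ≤
              (1 - ε) * (maxDegreeScale (meanDegree d n (r n)) α - meanDegree d n (r n))) ∨
         (Tendsto (fun n => meanDegree d n (r n)) atTop atTop ∧
            (fun n => meanDegree d n (r n)) =o[atTop] (fun n => (n : ℝ)) ∧
            (fun n => (k n : ℝ)) =O[atTop] (fun n => √(meanDegree d n (r n))))) :
    Tendsto (fun n => plantedLaw d n (k n) (vdFails d (r n) (k n))) atTop (𝓝 1) := by
  rcases h with ⟨α, ε, hα, hε, hμα, hkα⟩ | ⟨hμ, hμn, hkμ⟩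
  · exact tendsto_plantedLaw_vdFails_of_tendsto_div_log hr hk hα hε hμα hkα
  · exact tendsto_plantedLaw_vdFails_of_isBigO_sqrt hr hk hμ hμn hkμ

theorem theorem3 (d : ℕ) (hd : 1 ≤ d) (r : ℕ → ℝ) (hr : ∀ n, 0 < r n ∧ r n < 1 / 4)
    (k : ℕ → ℕ) (hk : ∀ n, 2 ≤ k n)
    (h : (∃ α ε : ℝ, 0 < α ∧ 0 < ε ∧ ε < 1 ∧
            Tendsto (fun n => meanDegree d n (r n) / Real.log n) atTop (𝓝 α) ∧
            ∀ᶠ n in atTop, (k n : ℝ) ≤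
              (1 - ε) * (maxDegreeScale (meanDegree d n (r n)) α - meanDegree d n (r n))) ∨
         (Tendsto (fun n => meanDegree d n (r n) / Real.log n) atTop atTop ∧
            (fun n => meanDegree d n (r n)) =o[atTop] (fun n => (n : ℝ)) ∧
            (fun n => (k n : ℝ)) =o[atTop] (fun n => √(meanDegree d n (r n))))) :
    Tendsto (fun n => plantedLaw d n (k n) (vdFails d (r n) (k n))) atTop (𝓝 1) :=
  theorem3_general hr (fun n => one_le_two.trans (hk n)) <|
    h.imp (fun ⟨α, ε, hα, hε, _, hμα, hkα⟩ => ⟨α, ε, hα, hε, hμα, hkα⟩) fun ⟨hμ, hμn, hkμ⟩ =>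
      ⟨tendsto_atTop_of_le_div_log one_pos (hμ.eventually_ge_atTop 1), hμn, hkμ.isBigO⟩
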